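/- Let $H=\bigoplus_{n\ge 0}H_n$ be a connected graded commutative Hopf algebra over $\mathbb C$ (with $\Delta H_n\subseteq\bigoplus_{p+q=n}H_p\otimes H_q$, $\varepsilon(H_n)=0$ for $n>0$, $H_0=\mathbb C\cdot 1$). Let $\mathcal A=\mathbb C((\lambda))$ be the algebra of formal Laurent series, $\mathcal A_+=\mathbb C[[\lambda]]$, $\mathcal A_-=\lambda^{-1}\mathbb C[\lambda^{-1}]$, let $P_\pm:\mathcal A\to\mathcal A_\pm$ be the projections belonging to $\mathcal A=\mathcal A_+\oplus\mathcal A_-$, and $R=P_+-P_-$. Let $G_{\mathcal A}$ be the group of unital algebra morphisms $H\to\mathcal A$ under convolution $\star$, and let $\mathfrak g_{\mathcal A}$ be the Lie algebra of infinitesimal characters, i.e. linear maps $Z:H\to\mathcal A$ with $Z(xy)=Z(x)\varepsilon(y)+\varepsilon(x)Z(y)$, with bracket $[Z,Z']=Z\star Z'-Z'\star Z$. Let $G_{\mathcal A}$ act on $\mathfrak g_{\mathcal A}$ by $\mathrm{Ad}(g)Z=g\star Z\star g^{-1}$, and let $R$ act on $\mathfrak g_{\mathcal A}$ by $Z\mapsto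 R\circ Z$. A Birkhoff factorization of $\varphi\in G_{\mathcal A}$ is a pair $g_\pm\in G_{\mathcal A}$ with $\varphi=g_-^{-1}\star g_+$, $g_+(H)\subseteq\mathcal A_+$ and $g_-(\ker\varepsilon)\subseteq\mathcal A_-$. Give $\mathcal A=\bigcup_N\lambda^{-N}\mathbb C[[\lambda]]$ the inductive limit topology: a curve in $\mathcal A$ is continuous (differentiable at a point) iff its pole order is locally bounded (bounded near the point) and each coefficient is continuous (differentiable at the point). Give $\mathfrak g_{\mathcal A}$ the topology of pointwise convergence on $H$. For a map $M:\mathfrak g_{\mathcal A}\to\mathfrak g_{\mathcal A}$, a solution of $\frac{dL}{dt}=[L,M(L)]$, $L(0)=L_0$ on an open interval $I\ni 0$ is a curve $L:I\to\mathfrak g_{\mathcal A}$ with $L(0)=L_0$ along which $t\mapsto M(L(t))$ is continuous and which is differentiable with derivative $[L(t),M(L(t))]$ at every $t\in I$. Let $f:\mathfrak g_{\mathcal A}\to\mathfrak g_{\mathcal A}$ be an $\mathrm{Ad}$-covariant map, i.e. $\mathrm{Ad}(g)f(L)=f(\mathrm{Ad}(g)L)$ for all $g\in G_{\mathcal A}$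 and $L\in\mathfrak g_{\mathcal A}$. Let $L_0\in\mathfrak g_{\mathcal A}$ satisfy $[f(L_0),L_0]=0$, and set $X=f(L_0)$. Then for every $t\in\mathbb R$ the locally finite series $\exp(-tX)=\sum_{n\ge0}\frac{(-t)^n}{n!}X^{\star n}$ is an element of $G_{\mathcal A}$ and has a unique Birkhoff factorization $\exp(-tX)=g_-(t)^{-1}\star g_+(t)$. Moreover $\mathrm{Ad}(g_-(t))L_0=\mathrm{Ad}(g_+(t))L_0$ for all $t$, and the curve $$L(t)=\mathrm{Ad}(g_\pm(t))L_0$$ is the solution of the Lax equation $$\frac{dL}{dt}=[L,M],\qquad M=\tfrac12R(f(L)),\qquad L(0)=L_0 .$$ That is, it is a solution on $\mathbb R$, and every solution on an open interval containing $0$ coincides with it on that interval. In particular, for all $n,m\in\mathbb Z$ the map $f(L)=2\lambda^{-n+2m}L$ is $\mathrm{Ad}$-covariant and satisfies $[f(L_0),L_0]=0$ for every $L_0\in\mathfrak g_{\mathcal A}$. Hence the solution of $\frac{dL}{dt}=[L,R(\lambda^{-n+2m}L)]$, $L(0)=L_0$, is $L(t)=\mathrm{Ad}(g_\pm(t))L_0$,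 where $\exp(-2t\lambda^{-n+2m}L_0)=g_-(t)^{-1}\star g_+(t)$ is the Birkhoff factorization. -/

import Mathlib

open scoped TensorProduct

noncomputable section

namespace LaxHopf

/-- A connected graded Hopf algebra over `ℂ`: an `ℕ`-grading of the algebra `H` for which the
coproduct and the counit are homogeneous of degree `0`, and whose degree `0` part is `ℂ · 1`.
(The antipode then preserves the degree automatically.) -/
structure IsConnectedGraded {H : Type*} [CommRing H] [HopfAlgebra ℂ H]
    (Hdeg : ℕ → Submodule ℂ H) [GradedAlgebra Hdeg] : Prop where
  comul_mem : ∀ n, ∀ x ∈ Hdeg n, Coalgebra.comul (R := ℂ) x ∈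
    ⨆ p ∈ Finset.HasAntidiagonal.antidiagonal n,
      LinearMap.range (TensorProduct.map (Hdeg p.1).subtype (Hdeg p.2).subtype)
  counit_eq_zero : ∀ n, n ≠ 0 → ∀ x ∈ Hdeg n, Coalgebra.counit (R := ℂ) x = 0
  connected : Hdeg 0 = Submodule.span ℂ {1}

/-! ### Laurent series -/

/-- The algebra `𝒜 = ℂ((λ))` of formal Laurent series with finitely many negative powers.
It is a type synonym of Mathlib's `LaurentSeries ℂ`, carrying one fixed `ℂ`-algebra structure. -/
def Laurent : Type := LaurentSeries ℂ

namespace Laurent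

instance : CommRing Laurent := inferInstanceAs (CommRing (HahnSeries ℤ ℂ))

instance : Algebra ℂ Laurent := HahnSeries.instAlgebra (Γ := ℤ) (R := ℂ) (A := ℂ)

/-- The coefficient of `λ ^ k`. -/
def coeff (a : Laurent) (k : ℤ) : ℂ := HahnSeries.coeff (show HahnSeries ℤ ℂ from a) k

theorem coeff_add (a b : Laurent) (k : ℤ) : (a + b).coeff k = a.coeff k + b.coeff k := rfl

theorem coeff_smul (c : ℂ) (a : Laurent) (k : ℤ) : (c • a).coeff k = c * a.coeff k := rfl

@[ext] theorem ext {a b : Laurent} (h : ∀ k, a.coeff k = b.coeff k) : a = b :=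
  HahnSeries.ext (funext h)

/-- The monomial `λ ^ k`. -/
def lamPow (k : ℤ) : Laurent := HahnSeries.single (Γ := ℤ) k (1 : ℂ)

/-- The pole part: the projection of `𝒜` onto `𝒜₋ = λ⁻¹ ℂ[λ⁻¹]` along `𝒜₊ = ℂ[[λ]]`. -/
def polePart : Laurent →ₗ[ℂ] Laurent where
  toFun a := HahnSeries.truncLT (Γ := ℤ) 0 a
  map_add' a b := HahnSeries.truncLT_add (Γ := ℤ) 0 a b
  map_smul' c a := HahnSeries.truncLT_smul (Γ := ℤ) 0 c a

theorem coeff_polePart (a : Laurent) (k : ℤ) :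
    (polePart a).coeff k = if k < 0 then a.coeff k else 0 := by
  split_ifs with h
  · exact HahnSeries.coeff_truncLT_of_lt h _
  · exact HahnSeries.coeff_truncLT_of_le (not_lt.mp h) _

/-- The holomorphic part: the projection of `𝒜` onto `𝒜₊` along `𝒜₋`. -/
def holoPart : Laurent →ₗ[ℂ] Laurent := LinearMap.id - polePart

/-- Membership in `𝒜₊ = ℂ[[λ]]`. -/
def IsHolo (a : Laurent) : Prop := ∀ k : ℤ, k < 0 → a.coeff k = 0

/-- Membership in `𝒜₋ = λ⁻¹ ℂ[λ⁻¹]`. -/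
def IsPolar (a : Laurent) : Prop := ∀ k : ℤ, 0 ≤ k → a.coeff k = 0

/-- The pole orders of `u s` are bounded for `s ∈ S` near `t`. -/
def PolesBoundedNear (u : ℝ → Laurent) (S : Set ℝ) (t : ℝ) : Prop :=
  ∃ N : ℤ, ∀ᶠ s in nhdsWithin t S, ∀ k < N, (u s).coeff k = 0

/-- Continuity on `S` of a curve in `ℂ((λ)) = ⋃ N, λ⁻ᴺ ℂ[[λ]]` (inductive limit of the spaces
`λ⁻ᴺ ℂ[[λ]]`, each with the topology of coefficientwise convergence): pole orders are locally
bounded and each coefficient is continuous. -/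
def CurveContinuousOn (u : ℝ → Laurent) (S : Set ℝ) : Prop :=
  ∀ t ∈ S, PolesBoundedNear u S t ∧ ∀ k : ℤ, ContinuousWithinAt (fun s => (u s).coeff k) S t

/-- The curve `u` in `ℂ((λ))` has derivative `u'` at `t`: pole orders are bounded near `t` and
each coefficient is differentiable at `t`, with derivative the coefficient of `u'`. -/
def HasCurveDerivAt (u : ℝ → Laurent) (u' : Laurent) (t : ℝ) : Prop :=
  PolesBoundedNear u Set.univ t ∧
    ∀ k : ℤ, HasDerivAt (fun s => (u s).coeff k) (u'.coeff k) t

end Laurent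

/-! ### Characters and infinitesimal characters -/

section

variable (H : Type*) [CommRing H] [HopfAlgebra ℂ H]

/-- Linear maps `H → 𝒜`, a ring under the convolution product. -/
abbrev Conv := WithConv (H →ₗ[ℂ] Laurent)

/-- The group of unital algebra morphisms `H → 𝒜` under the convolution product. -/
abbrev CharGroup := WithConv (H →ₐ[ℂ] Laurent)

variable {H}

/-- A character as an element of the convolution algebra. -/
def toConvLin (g : CharGroup H) : Conv H := WithConv.toConv g.ofConv.toLinearMap

theorem toConvLin_mul (g h : CharGroup H) :
    toConvLin (g * h) = toConvLin g * toConvLin h := rfl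

theorem toConvLin_one : toConvLin (1 : CharGroup H) = 1 := rfl

theorem toConvLin_injective : Function.Injective (toConvLin (H := H)) := fun _ _ h =>
  WithConv.ofConv_injective (AlgHom.toLinearMap_injective (WithConv.toConv_injective h))

/-- The inverse of a character is its composition with the antipode. -/
instance : Inv (CharGroup H) where
  inv g := WithConv.toConv (g.ofConv.comp (HopfAlgebra.antipodeAlgHom ℂ H))

instance : Group (CharGroup H) where
  inv_mul_cancel g := by
    apply toConvLin_injective
    have h := LinearMap.algHom_comp_convMul_distrib g.ofConv
      (WithConv.toConv (HopfAlgebra.antipode ℂ (A := H))) (WithConv.toConv LinearMap.id)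
    rw [LinearMap.antipode_mul_id] at h
    refine (congrArg WithConv.toConv h).symm.trans ?_
    apply WithConv.ext
    refine LinearMap.ext fun x => ?_
    exact AlgHom.commutes g.ofConv _

/-- `Z (x y) = Z x ε(y) + ε(x) Z y`. -/
def IsInfChar (Z : Conv H) : Prop :=
  ∀ x y : H, Z (x * y) = Z x * algebraMap ℂ Laurent (Coalgebra.counit (R := ℂ) y) +
    algebraMap ℂ Laurent (Coalgebra.counit (R := ℂ) x) * Z y

/-- The map `x ⊗ y ↦ Z (x y)`. -/
def mulPull (Z : Conv H) : WithConv (H ⊗[ℂ] H →ₗ[ℂ] Laurent) :=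
  WithConv.toConv (Z.ofConv ∘ₗ LinearMap.mul' ℂ H)

/-- The map `x ⊗ y ↦ Z x * W y`. -/
def tens (Z W : Conv H) : WithConv (H ⊗[ℂ] H →ₗ[ℂ] Laurent) :=
  WithConv.toConv (LinearMap.mul' ℂ Laurent ∘ₗ TensorProduct.map Z.ofConv W.ofConv)

theorem mulPull_mul (Z W : Conv H) : mulPull (Z * W) = mulPull Z * mulPull W :=
  congrArg WithConv.toConv
    (LinearMap.convMul_comp_coalgHom_distrib Z W (Bialgebra.mulCoalgHom ℂ H))

theorem tens_mul (Z W Z' W' : Conv H) :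
    tens Z W * tens Z' W' = tens (Z * Z') (W * W') := by
  have h := LinearMap.algHom_comp_convMul_distrib (R := ℂ)
    (Algebra.TensorProduct.lmul' ℂ (S := Laurent))
    (WithConv.toConv (TensorProduct.map Z.ofConv W.ofConv))
    (WithConv.toConv (TensorProduct.map Z'.ofConv W'.ofConv))
  rw [TensorProduct.map_convMul_map] at h
  exact (congrArg WithConv.toConv h).symm

theorem isInfChar_iff (Z : Conv H) :
    IsInfChar Z ↔ mulPull Z = tens Z 1 + tens 1 Z := by
  constructor
  · intro h
    apply WithConv.ext
    ext x y : 3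
    exact h x y
  · intro h x y
    exact congrArg (fun F : WithConv (H ⊗[ℂ] H →ₗ[ℂ] Laurent) => F (x ⊗ₜ[ℂ] y)) h

theorem mulPull_toConvLin (g : CharGroup H) :
    mulPull (toConvLin g) = tens (toConvLin g) (toConvLin g) := by
  apply WithConv.ext
  ext x y : 3
  exact map_mul g.ofConv x y

theorem tens_sub_left (Z Z' W : Conv H) : tens (Z - Z') W = tens Z W - tens Z' W := by
  apply WithConv.ext
  ext x y : 3
  exact sub_mul (Z x) (Z' x) (W y)

theorem tens_sub_right (Z W W' : Conv H) : tens Z (W - W') = tens Z W - tens Z W' := by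
  apply WithConv.ext
  ext x y : 3
  exact mul_sub (Z x) (W y) (W' y)

/-- The commutator bracket on the convolution algebra. -/
instance : LieRing (Conv H) := LieRing.ofAssociativeRing

instance : LieAlgebra Laurent (Conv H) := LieAlgebra.ofAssociativeAlgebra

instance : IsScalarTower ℂ Laurent (Conv H) where
  smul_assoc c a Z := by
    apply WithConv.ext
    refine LinearMap.ext fun x => ?_
    exact smul_assoc c a (Z x)

variable (H) in
/-- The Lie algebra of `𝒜`-valued infinitesimal characters of `H`, with the commutator bracket
`⁅Z, Z'⁆ = Z ⋆ Z' - Z' ⋆ Z`. -/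
def infChar : LieSubalgebra Laurent (Conv H) where
  carrier := {Z | IsInfChar Z}
  zero_mem' := by
    intro x y
    change (0 : Laurent) = 0 * _ + _ * 0
    simp
  add_mem' := by
    intro Z W hZ hW x y
    change Z (x * y) + W (x * y) = (Z x + W x) * _ + _ * (Z y + W y)
    rw [hZ x y, hW x y]
    ring
  smul_mem' := by
    intro a Z hZ x y
    change a * Z (x * y) = (a * Z x) * _ + _ * (a * Z y)
    rw [hZ x y]
    ring
  lie_mem' := by
    intro Z W hZ hW
    change IsInfChar (Z * W - W * Z)
    have hZ' := (isInfChar_iff Z).1 hZ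
    have hW' := (isInfChar_iff W).1 hW
    have hs : mulPull (Z * W - W * Z) = mulPull (Z * W) - mulPull (W * Z) := rfl
    rw [isInfChar_iff, hs, mulPull_mul, mulPull_mul, hZ', hW', tens_sub_left, tens_sub_right]
    simp only [mul_add, add_mul, tens_mul, mul_one, one_mul]
    abel

/-- The adjoint action `Ad(g) Z = g ⋆ Z ⋆ g⁻¹` of characters on infinitesimal characters. -/
def Ad (g : CharGroup H) (Z : infChar H) : infChar H :=
  ⟨toConvLin g * (Z : Conv H) * toConvLin g⁻¹, by
    have hZ' := (isInfChar_iff (Z : Conv H)).1 Z.2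
    have hg : toConvLin g * toConvLin g⁻¹ = 1 := by
      rw [← toConvLin_mul, mul_inv_cancel, toConvLin_one]
    refine (isInfChar_iff _).2 ?_
    rw [mulPull_mul, mulPull_mul, mulPull_toConvLin, mulPull_toConvLin, hZ']
    simp only [mul_add, add_mul, tens_mul, mul_one, hg]⟩

/-- `f (Ad(g) L) = Ad(g) (f L)` for all characters `g` and infinitesimal characters `L`. -/
def IsAdCovariant (f : infChar H → infChar H) : Prop :=
  ∀ (g : CharGroup H) (L : infChar H), Ad g (f L) = f (Ad g L)

/-- Composition of an infinitesimal character with a `ℂ`-linear map `𝒜 → 𝒜`. -/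
def postcomp (T : Laurent →ₗ[ℂ] Laurent) (Z : infChar H) : infChar H :=
  ⟨WithConv.toConv (T ∘ₗ (Z : Conv H).ofConv), by
    intro x y
    change T ((Z : Conv H) (x * y)) = T ((Z : Conv H) x) * _ + _ * T ((Z : Conv H) y)
    rw [Z.2 x y, map_add, mul_comm _ (algebraMap ℂ Laurent _), mul_comm _ (algebraMap ℂ Laurent _),
      ← Algebra.smul_def, ← Algebra.smul_def, ← Algebra.smul_def, ← Algebra.smul_def,
      map_smul, map_smul]⟩

/-- `R = P₊ - P₋` on infinitesimal characters. -/
def RMap (Z : infChar H) : infChar H :=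
  postcomp Laurent.holoPart Z - postcomp Laurent.polePart Z

/-- `φ = exp(Z) = ∑ n, Z^{⋆n} / n!`, the sum being locally finite: on each `x` the partial sums
are eventually constant, equal to `φ x`. -/
def IsExp (Z : infChar H) (φ : CharGroup H) : Prop :=
  ∀ x : H, ∃ N : ℕ, ∀ n ≥ N,
    ∑ i ∈ Finset.range n, ((i.factorial : ℂ)⁻¹) • (((Z : Conv H) ^ i : Conv H) x) = φ x

/-- The Connes-Kreimer Birkhoff factorization `φ = g₋⁻¹ ⋆ g₊`: `g₊` takes values in `𝒜₊`, and
`g₋` maps the augmentation ideal into `𝒜₋`. -/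
def IsBirkhoff (φ gm gp : CharGroup H) : Prop :=
  φ = gm⁻¹ * gp ∧
    (∀ x : H, (gp x).IsHolo) ∧
    (∀ x : H, Coalgebra.counit (R := ℂ) x = 0 → (gm x).IsPolar)

/-- `L` solves `dL/dt = [L, M(L)]`, `L(0) = L₀` on `I`: the curve `t ↦ M(L(t))` is continuous and
`L` is differentiable with derivative `[L(t), M(L(t))]` (in the topology of pointwise convergence
on `H`). -/
structure IsLaxSolutionOn (M : infChar H → infChar H) (L₀ : infChar H) (I : Set ℝ)
    (L : ℝ → infChar H) : Prop where
  initial : L 0 = L₀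
  continuousOn : ∀ x : H, Laurent.CurveContinuousOn (fun t => (M (L t) : Conv H) x) I
  hasDerivAt : ∀ t ∈ I, ∀ x : H, Laurent.HasCurveDerivAt (fun s => (L s : Conv H) x)
    (((⁅L t, M (L t)⁆ : infChar H) : Conv H) x) t

/-- For every `t : ℝ` the exponential `exp(-t X)` exists as a character and has exactly one Birkhoff
factorization `g₋(t)⁻¹ ⋆ g₊(t)`; one has `Ad(g₋(t)) L₀ = Ad(g₊(t)) L₀` for all `t`; and this curve is
the solution of `dL/dt = [L, M(L)]`, `L(0) = L₀`: it is a solution on `ℝ`, and any solution on an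
open interval around `0` coincides with it there. -/
def IsSolvedByBirkhoff (M : infChar H → infChar H) (L₀ X : infChar H) : Prop :=
  (∀ t : ℝ, ∃ φ : CharGroup H, IsExp (-(t : ℂ) • X) φ ∧
    ∃! p : CharGroup H × CharGroup H, IsBirkhoff φ p.1 p.2) ∧
  ∀ φ gm gp : ℝ → CharGroup H,
    (∀ t : ℝ, IsExp (-(t : ℂ) • X) (φ t) ∧ IsBirkhoff (φ t) (gm t) (gp t)) →
      (∀ t, Ad (gm t) L₀ = Ad (gp t) L₀) ∧
      IsLaxSolutionOn M L₀ Set.univ (fun t => Ad (gp t) L₀) ∧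
      ∀ I : Set ℝ, IsOpen I → I.OrdConnected → (0 : ℝ) ∈ I → ∀ L : ℝ → infChar H,
        IsLaxSolutionOn M L₀ I L → ∀ t ∈ I, L t = Ad (gp t) L₀

end

end LaxHopf

end

/-! The differential equation is reduced to algebra by the grading. An element `A` of the convolution
algebra with `A(1) = 0` kills the degree `0` part `ℂ · 1` of `H`, so the values of `K ⋆ A` and
`A ⋆ K` in degree `n` only involve `K` in degrees less than `n`. Two principles follow, both valid
over any graded coalgebra: an equation `K = B + T ∘ (K ⋆ A)`, with `T` any linear endomorphism of
the target algebra, has exactly one solution (`IsGradedCoalgebra.exists_fixedPoint`,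
`IsGradedCoalgebra.eq_of_fixedPoint`), and a differential equation whose right-hand side is
triangular for the degree has at most one (`IsGradedCoalgebra.eq_of_triangular`). Applied over the
coalgebra `H ⊗ H`, uniqueness shows that solutions over `H` are multiplicative: `K(xy)` and
`K(x) K(y)` solve the same equation.

*Birkhoff factorization.* The polar factor of `φ` is the solution of
`g₋ = ε - P₋ ∘ (g₋ ⋆ (φ - ε))` (`exists_isBirkhoff`, `IsBirkhoff.unique`). By induction on the
degree the same equation shows that `g₋(t)` is differentiable when `φ(t)` is.

*The curve is a solution.* Differentiating `g₋ ⋆ exp(-tX) = g₊` gives `Ad(g₊) X = a - b` with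
`a = g₋' ⋆ g₋⁻¹` polar and `b = g₊' ⋆ g₊⁻¹` holomorphic, so `R(Ad(g₊) X) = -a - b`. By covariance
`f(L) = Ad(g₊) X` for `L = Ad(g₊) L₀`; this commutes with `L`, whence
`L' = [b, L] = [L, R(f(L)) / 2]` (`exists_hasConvDerivAt_holoFactor`, `isLaxSolutionOn_birkhoff`).

*Uniqueness.* No regularity of `f` is assumed, so the equation is not directly amenable to an
existence and uniqueness theorem. But along a solution `M(L(t))` is continuous, so `k' = k ⋆ M(L)`,
`k(0) = 1` is solvable by characters: it is the fixed point equation with `T` the integration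
operator on continuous curves in `𝒜` (`exists_char_curve`). Then `L = Ad(k⁻¹) L₀`, hence
`F = f(L) = Ad(k⁻¹) X` satisfies the closed equation `F' = [F, R(F) / 2]`
(`IsLaxSolutionOn.hasConvDerivAt_covariant`). This equation is triangular, so it determines `F`,
therefore `M(L)`, and finally `L` (`IsLaxSolutionOn.unique`). -/

noncomputable section

namespace LaxHopf

namespace Laurent

/-! ### Coefficients of Laurent series -/

theorem coeff_zero (k : ℤ) : (0 : Laurent).coeff k = 0 := rfl

theorem coeff_neg (a : Laurent) (k : ℤ) : (-a).coeff k = -a.coeff k := rfl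

theorem coeff_algebraMap (c : ℂ) (k : ℤ) :
    (algebraMap ℂ Laurent c).coeff k = if k = 0 then c else 0 := by
  rw [Algebra.algebraMap_eq_smul_one, coeff_smul]
  change c * (HahnSeries.coeff (1 : HahnSeries ℤ ℂ) k) = _
  rw [HahnSeries.coeff_one]
  split_ifs <;> simp

theorem exists_coeff_eq_zero_of_lt (a : Laurent) : ∃ N : ℤ, ∀ k < N, a.coeff k = 0 :=
  ⟨HahnSeries.order (Γ := ℤ) (R := ℂ) a, fun _ hk => HahnSeries.coeff_eq_zero_of_lt_order hk⟩

/-- Once the pole orders of both factors are bounded, each coefficient of a product is given by a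
finite sum whose index set no longer depends on the factors. -/
theorem coeff_mul_of_bounded {a b : Laurent} {N N' : ℤ} (ha : ∀ k < N, a.coeff k = 0)
    (hb : ∀ k < N', b.coeff k = 0) (k : ℤ) :
    (a * b).coeff k = ∑ i ∈ Finset.Icc N (k - N'), a.coeff i * b.coeff (k - i) := by
  refine (HahnSeries.coeff_mul (Γ := ℤ) (R := ℂ) (x := a) (y := b)).trans ?_
  refine Finset.sum_of_injOn Prod.fst ?_ ?_ ?_ ?_
  · rintro ⟨i, j⟩ h ⟨i', j'⟩ h' (rfl : i = i')
    simp only [Finset.mem_coe, Finset.mem_antidiagonal] at h h'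
    have := h.2.2
    have := h'.2.2
    grind
  · rintro ⟨i, j⟩ h
    simp only [Finset.mem_coe, Finset.mem_antidiagonal] at h
    have hi : N ≤ i := not_lt.1 fun hlt => h.1 (ha i hlt)
    have hj : N' ≤ j := not_lt.1 fun hlt => h.2.1 (hb j hlt)
    simp only [Finset.coe_Icc, Set.mem_Icc]
    omega
  · intro i _ hi
    by_contra hne
    refine hi ⟨(i, k - i), ?_, rfl⟩
    simp only [Finset.mem_coe, Finset.mem_antidiagonal]
    exact ⟨left_ne_zero_of_mul hne, right_ne_zero_of_mul hne, by omega⟩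
  · rintro ⟨i, j⟩ h
    simp only [Finset.mem_antidiagonal] at h
    obtain rfl : j = k - i := by omega
    rfl

/-! ### Subspaces of Laurent series -/

/-- `𝒜₊ = ℂ[[λ]]` as a subspace of `𝒜`. -/
def holo : Submodule ℂ Laurent where
  carrier := {a | a.IsHolo}
  zero_mem' _ _ := rfl
  add_mem' ha hb k hk := by rw [coeff_add, ha k hk, hb k hk, add_zero]
  smul_mem' c a ha k hk := by rw [coeff_smul, ha k hk, mul_zero]

/-- `𝒜₋ = λ⁻¹ ℂ[λ⁻¹]` as a subspace of `𝒜`. -/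
def polar : Submodule ℂ Laurent where
  carrier := {a | a.IsPolar}
  zero_mem' _ _ := rfl
  add_mem' ha hb k hk := by rw [coeff_add, ha k hk, hb k hk, add_zero]
  smul_mem' c a ha k hk := by rw [coeff_smul, ha k hk, mul_zero]

theorem algebraMap_mem_holo (c : ℂ) : algebraMap ℂ Laurent c ∈ holo := fun k hk => by
  rw [coeff_algebraMap, if_neg hk.ne]

theorem mul_mem_holo {a b : Laurent} (ha : a ∈ holo) (hb : b ∈ holo) : a * b ∈ holo :=
  fun k hk => by
    rw [coeff_mul_of_bounded ha hb, Finset.Icc_eq_empty (by omega), Finset.sum_empty]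

theorem mul_mem_polar {a b : Laurent} (ha : a ∈ polar) (hb : b ∈ polar) : a * b ∈ polar :=
  fun k hk => by
    obtain ⟨N, hN⟩ := exists_coeff_eq_zero_of_lt a
    obtain ⟨N', hN'⟩ := exists_coeff_eq_zero_of_lt b
    rw [coeff_mul_of_bounded hN hN']
    refine Finset.sum_eq_zero fun i _ => ?_
    rcases le_or_gt 0 i with hi | hi
    · rw [ha i hi, zero_mul]
    · rw [hb (k - i) (by omega), mul_zero]

theorem mul_algebraMap_mem_polar {a : Laurent} (ha : a ∈ polar) (c : ℂ) :
    a * algebraMap ℂ Laurent c ∈ polar := by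
  rw [mul_comm, ← Algebra.smul_def]
  exact polar.smul_mem c ha

theorem polePart_mem_polar (a : Laurent) : polePart a ∈ polar := fun k hk => by
  rw [coeff_polePart, if_neg hk.not_gt]

theorem polePart_of_mem_holo {a : Laurent} (ha : a ∈ holo) : polePart a = 0 := by
  ext k
  rw [coeff_polePart]
  split_ifs with hk
  · exact ha k hk
  · rfl

theorem polePart_of_mem_polar {a : Laurent} (ha : a ∈ polar) : polePart a = a := by
  ext k
  rw [coeff_polePart]
  split_ifs with hk
  · rfl
  · exact (ha k (not_lt.1 hk)).symm

theorem mem_holo_of_polePart_eq_zero {a : Laurent} (ha : polePart a = 0) : a ∈ holo :=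
  fun k hk => by
    have h := coeff_polePart a k
    rwa [ha, if_pos hk, coeff_zero, eq_comm] at h

/-! ### Calculus of curves of Laurent series -/

variable {u v : ℝ → Laurent} {S : Set ℝ} {t : ℝ} {a b : Laurent}

theorem PolesBoundedNear.add (hu : PolesBoundedNear u S t) (hv : PolesBoundedNear v S t) :
    PolesBoundedNear (fun s => u s + v s) S t := by
  obtain ⟨N, hN⟩ := hu
  obtain ⟨N', hN'⟩ := hv
  refine ⟨min N N', ?_⟩
  filter_upwards [hN, hN'] with s h h' k hk
  rw [coeff_add, h k (lt_of_lt_of_le hk (min_le_left _ _)),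
    h' k (lt_of_lt_of_le hk (min_le_right _ _)), add_zero]

theorem PolesBoundedNear.mul (hu : PolesBoundedNear u S t) (hv : PolesBoundedNear v S t) :
    PolesBoundedNear (fun s => u s * v s) S t := by
  obtain ⟨N, hN⟩ := hu
  obtain ⟨N', hN'⟩ := hv
  refine ⟨N + N', ?_⟩
  filter_upwards [hN, hN'] with s h h' k hk
  rw [coeff_mul_of_bounded h h', Finset.Icc_eq_empty (by omega), Finset.sum_empty]

theorem PolesBoundedNear.mono_coeff (hu : PolesBoundedNear u S t)
    (h : ∀ s k, (u s).coeff k = 0 → (v s).coeff k = 0) : PolesBoundedNear v S t := by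
  obtain ⟨N, hN⟩ := hu
  exact ⟨N, hN.mono fun s hs k hk => h s k (hs k hk)⟩

theorem polesBoundedNear_const (a : Laurent) (S : Set ℝ) (t : ℝ) :
    PolesBoundedNear (fun _ => a) S t := by
  obtain ⟨N, hN⟩ := exists_coeff_eq_zero_of_lt a
  exact ⟨N, Filter.Eventually.of_forall fun _ => hN⟩

theorem PolesBoundedNear.exists_eventually_coeff_mul (hu : PolesBoundedNear u S t)
    (hv : PolesBoundedNear v S t) (k : ℤ) : ∃ A : Finset ℤ,
      ∀ᶠ s in nhdsWithin t S,
        (u s * v s).coeff k = ∑ i ∈ A, (u s).coeff i * (v s).coeff (k - i) := by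
  obtain ⟨N, hN⟩ := hu
  obtain ⟨N', hN'⟩ := hv
  refine ⟨Finset.Icc N (k - N'), ?_⟩
  filter_upwards [hN, hN'] with s h h' using coeff_mul_of_bounded h h' k

theorem CurveContinuousOn.add (hu : CurveContinuousOn u S) (hv : CurveContinuousOn v S) :
    CurveContinuousOn (fun s => u s + v s) S := fun t ht =>
  ⟨(hu t ht).1.add (hv t ht).1, fun k => ((hu t ht).2 k).add ((hv t ht).2 k)⟩

theorem curveContinuousOn_const (a : Laurent) (S : Set ℝ) : CurveContinuousOn (fun _ => a) S :=
  fun t _ => ⟨polesBoundedNear_const a S t, fun _ => continuousWithinAt_const⟩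

theorem CurveContinuousOn.mul (hu : CurveContinuousOn u S) (hv : CurveContinuousOn v S) :
    CurveContinuousOn (fun s => u s * v s) S := fun t ht => by
  refine ⟨(hu t ht).1.mul (hv t ht).1, fun k => ?_⟩
  obtain ⟨A, hA⟩ := (hu t ht).1.exists_eventually_coeff_mul (hv t ht).1 k
  refine ContinuousWithinAt.congr_of_eventuallyEq ?_ hA (hA.self_of_nhdsWithin ht)
  exact tendsto_finsetSum _ fun i _ => ((hu t ht).2 i).mul ((hv t ht).2 (k - i))

theorem CurveContinuousOn.mono {S' : Set ℝ} (hu : CurveContinuousOn u S) (h : S' ⊆ S) :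
    CurveContinuousOn u S' := fun t ht =>
  ⟨(hu t (h ht)).1.imp fun _ hN => hN.filter_mono (nhdsWithin_mono t h),
    fun k => ((hu t (h ht)).2 k).mono h⟩

theorem HasCurveDerivAt.add (hu : HasCurveDerivAt u a t) (hv : HasCurveDerivAt v b t) :
    HasCurveDerivAt (fun s => u s + v s) (a + b) t :=
  ⟨hu.1.add hv.1, fun k => (hu.2 k).add (hv.2 k)⟩

theorem HasCurveDerivAt.const_smul (c : ℂ) (hu : HasCurveDerivAt u a t) :
    HasCurveDerivAt (fun s => c • u s) (c • a) t :=
  ⟨hu.1.mono_coeff fun s k h => by rw [coeff_smul, h, mul_zero], fun k => (hu.2 k).const_mul c⟩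

theorem HasCurveDerivAt.neg (hu : HasCurveDerivAt u a t) :
    HasCurveDerivAt (fun s => -u s) (-a) t :=
  ⟨hu.1.mono_coeff fun s k h => by rw [coeff_neg, h, neg_zero], fun k => (hu.2 k).neg⟩

theorem HasCurveDerivAt.sub (hu : HasCurveDerivAt u a t) (hv : HasCurveDerivAt v b t) :
    HasCurveDerivAt (fun s => u s - v s) (a - b) t := by
  simpa only [sub_eq_add_neg] using hu.add hv.neg

theorem hasCurveDerivAt_const (a : Laurent) (t : ℝ) : HasCurveDerivAt (fun _ => a) 0 t :=
  ⟨polesBoundedNear_const a _ t, fun _ => hasDerivAt_const t _⟩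

theorem hasCurveDerivAt_smul_const {c : ℝ → ℂ} {c' : ℂ} (hc : HasDerivAt c c' t) (a : Laurent) :
    HasCurveDerivAt (fun s => c s • a) (c' • a) t :=
  ⟨(polesBoundedNear_const a _ t).mono_coeff fun s k h => by rw [coeff_smul, h, mul_zero],
    fun k => hc.mul_const (a.coeff k)⟩

theorem HasCurveDerivAt.sum {ι : Type*} {A : Finset ι} {w : ι → ℝ → Laurent} {w' : ι → Laurent}
    (h : ∀ i ∈ A, HasCurveDerivAt (w i) (w' i) t) :
    HasCurveDerivAt (fun s => ∑ i ∈ A, w i s) (∑ i ∈ A, w' i) t := by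
  classical
  induction A using Finset.induction_on with
  | empty => exact hasCurveDerivAt_const 0 t
  | insert i A hi ih =>
    simp only [Finset.sum_insert hi]
    exact (h i (Finset.mem_insert_self i A)).add (ih fun j hj => h j (Finset.mem_insert_of_mem hj))

theorem HasCurveDerivAt.mul (hu : HasCurveDerivAt u a t) (hv : HasCurveDerivAt v b t) :
    HasCurveDerivAt (fun s => u s * v s) (a * v t + u t * b) t := by
  refine ⟨hu.1.mul hv.1, fun k => ?_⟩
  -- The derivatives `a` and `b` may have more poles than the curves: bound all four at once.
  obtain ⟨N₁, h₁⟩ := hu.1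
  obtain ⟨N₂, h₂⟩ := hv.1
  obtain ⟨M₁, k₁⟩ := exists_coeff_eq_zero_of_lt a
  obtain ⟨M₂, k₂⟩ := exists_coeff_eq_zero_of_lt b
  have hN : ∀ᶠ s in nhdsWithin t Set.univ, ∀ k < min N₁ M₁, (u s).coeff k = 0 :=
    h₁.mono fun s hs k hk => hs k (lt_of_lt_of_le hk (min_le_left _ _))
  have hM : ∀ᶠ s in nhdsWithin t Set.univ, ∀ k < min N₂ M₂, (v s).coeff k = 0 :=
    h₂.mono fun s hs k hk => hs k (lt_of_lt_of_le hk (min_le_left _ _))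
  have ha : ∀ k < min N₁ M₁, a.coeff k = 0 := fun k hk =>
    k₁ k (lt_of_lt_of_le hk (min_le_right _ _))
  have hb : ∀ k < min N₂ M₂, b.coeff k = 0 := fun k hk =>
    k₂ k (lt_of_lt_of_le hk (min_le_right _ _))
  have hev : (fun s => (u s * v s).coeff k) =ᶠ[nhds t] fun s =>
      ∑ i ∈ Finset.Icc (min N₁ M₁) (k - min N₂ M₂), (u s).coeff i * (v s).coeff (k - i) := by
    rw [← nhdsWithin_univ]
    filter_upwards [hN, hM] with s h h' using coeff_mul_of_bounded h h' k
  refine HasDerivAt.congr_of_eventuallyEq ?_ hev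
  rw [coeff_add, coeff_mul_of_bounded ha (hM.self_of_nhdsWithin (Set.mem_univ t)),
    coeff_mul_of_bounded (hN.self_of_nhdsWithin (Set.mem_univ t)) hb, ← Finset.sum_add_distrib]
  exact HasDerivAt.fun_sum fun i _ => (hu.2 i).mul (hv.2 (k - i))

theorem HasCurveDerivAt.unique (hu : HasCurveDerivAt u a t) (hu' : HasCurveDerivAt u b t) :
    a = b := by
  ext k
  exact (hu.2 k).unique (hu'.2 k)

theorem HasCurveDerivAt.congr (hu : HasCurveDerivAt u a t) (hS : IsOpen S) (ht : t ∈ S)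
    (h : ∀ s ∈ S, v s = u s) : HasCurveDerivAt v a t := by
  have hev : ∀ᶠ s in nhds t, v s = u s := Filter.mem_of_superset (hS.mem_nhds ht) h
  refine ⟨?_, fun k => (hu.2 k).congr_of_eventuallyEq (hev.mono fun s hs => by simp only [hs])⟩
  obtain ⟨N, hN⟩ := hu.1
  refine ⟨N, ?_⟩
  rw [nhdsWithin_univ] at hN ⊢
  filter_upwards [hN, hev] with s h1 h2
  rwa [h2]

theorem HasCurveDerivAt.mem_holo (hu : HasCurveDerivAt u a t) (h : ∀ s, u s ∈ holo) :
    a ∈ holo := fun k hk => by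
  have h1 := hu.2 k
  simp only [fun s => h s k hk] at h1
  exact h1.unique (hasDerivAt_const t 0)

theorem HasCurveDerivAt.mem_polar (hu : HasCurveDerivAt u a t) (h : ∀ s, u s ∈ polar) :
    a ∈ polar := fun k hk => by
  have h1 := hu.2 k
  simp only [fun s => h s k hk] at h1
  exact h1.unique (hasDerivAt_const t 0)

theorem HasCurveDerivAt.polePart (hu : HasCurveDerivAt u a t) :
    HasCurveDerivAt (fun s => polePart (u s)) (polePart a) t := by
  refine ⟨hu.1.mono_coeff fun s k h => by rw [coeff_polePart, h, ite_self], fun k => ?_⟩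
  simp only [coeff_polePart]
  split_ifs
  · exact hu.2 k
  · exact hasDerivAt_const t _

theorem curveContinuousOn_of_hasCurveDerivAt {u' : ℝ → Laurent}
    (h : ∀ t ∈ S, HasCurveDerivAt u (u' t) t) : CurveContinuousOn u S := fun t ht =>
  ⟨(h t ht).1.imp fun _ hN => hN.filter_mono (nhdsWithin_mono t (Set.subset_univ S)),
    fun k => ((h t ht).2 k).continuousAt.continuousWithinAt⟩

theorem CurveContinuousOn.congr (hu : CurveContinuousOn u S) (h : ∀ t ∈ S, v t = u t) :
    CurveContinuousOn v S := fun t ht => by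
  refine ⟨?_, fun k => ((hu t ht).2 k).congr (fun s hs => by rw [h s hs]) (by rw [h t ht])⟩
  obtain ⟨N, hN⟩ := (hu t ht).1
  refine ⟨N, ?_⟩
  filter_upwards [hN, self_mem_nhdsWithin] with s hs hsS
  rwa [h s hsS]

/-- A curve with vanishing derivative on an open interval is constant there. -/
theorem eq_of_hasCurveDerivAt_zero (hS : IsOpen S) (hc : S.OrdConnected)
    (h : ∀ t ∈ S, HasCurveDerivAt u 0 t) {s t : ℝ} (hs : s ∈ S) (ht : t ∈ S) : u s = u t := by
  ext k
  refine hS.is_const_of_deriv_eq_zero hc.isPreconnected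
    (fun r hr => ((h r hr).2 k).differentiableAt.differentiableWithinAt)
    (fun r hr => ((h r hr).2 k).deriv) hs ht

/-! ### Integration of continuous curves of Laurent series -/

/-- The algebra of curves in `𝒜` that are continuous on `S`. Values outside `S` are arbitrary. -/
def contCurves (S : Set ℝ) : Subalgebra ℂ (ℝ → Laurent) where
  carrier := {u | CurveContinuousOn u S}
  mul_mem' hu hv := hu.mul hv
  add_mem' hu hv := hu.add hv
  algebraMap_mem' c := curveContinuousOn_const (algebraMap ℂ Laurent c) S

variable {u : ℝ → Laurent} {S : Set ℝ}

theorem CurveContinuousOn.continuousOn_coeff (hu : CurveContinuousOn u S) (k : ℤ) :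
    ContinuousOn (fun s => (u s).coeff k) S := fun t ht => (hu t ht).2 k

theorem CurveContinuousOn.exists_bound {K : Set ℝ} (hK : IsCompact K)
    (hu : CurveContinuousOn u K) : ∃ N : ℤ, ∀ s ∈ K, ∀ k < N, (u s).coeff k = 0 := by
  refine hK.induction_on (p := fun T => ∃ N : ℤ, ∀ s ∈ T, ∀ k < N, (u s).coeff k = 0)
    ⟨0, by simp⟩ (fun T T' h ⟨N, hN⟩ => ⟨N, fun s hs => hN s (h hs)⟩) ?_ fun t ht => ?_
  · rintro T T' ⟨N, hN⟩ ⟨N', hN'⟩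
    refine ⟨min N N', fun s hs k hk => ?_⟩
    rcases hs with hs | hs
    · exact hN s hs k (lt_of_lt_of_le hk (min_le_left _ _))
    · exact hN' s hs k (lt_of_lt_of_le hk (min_le_right _ _))
  · obtain ⟨N, hN⟩ := (hu t ht).1
    exact ⟨_, hN, N, fun s hs => hs⟩

/-- The Laurent series with a given sequence of coefficients. -/
def ofCoeff (c : ℤ → ℂ) (h : BddBelow (Function.support c)) : Laurent :=
  HahnSeries.ofSuppBddBelow c h

open Classical in
/-- The integral `∫₀ᵗ u` of a curve of Laurent series, coefficient by coefficient; it is `0` unless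
the integrals of the coefficients have bounded pole order. -/
def integral (u : ℝ → Laurent) (t : ℝ) : Laurent :=
  if h : BddBelow (Function.support fun k : ℤ => ∫ s in (0 : ℝ)..t, (u s).coeff k) then
    ofCoeff _ h
  else 0

theorem coeff_integral_of_bound {t : ℝ} {N : ℤ}
    (h : ∀ s ∈ Set.uIcc 0 t, ∀ k < N, (u s).coeff k = 0) (k : ℤ) :
    (integral u t).coeff k = ∫ s in (0 : ℝ)..t, (u s).coeff k := by
  have hb : BddBelow (Function.support fun k : ℤ => ∫ s in (0 : ℝ)..t, (u s).coeff k) := by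
    refine ⟨N, fun k hk => not_lt.1 fun hlt => hk ?_⟩
    simp only
    rw [intervalIntegral.integral_congr (g := fun _ => (0 : ℂ)) fun s hs => h s hs k hlt]
    simp
  rw [integral, dif_pos hb]
  rfl

theorem CurveContinuousOn.coeff_integral (hu : CurveContinuousOn u S) (hc : S.OrdConnected)
    (h0 : (0 : ℝ) ∈ S) {t : ℝ} (ht : t ∈ S) (k : ℤ) :
    (integral u t).coeff k = ∫ s in (0 : ℝ)..t, (u s).coeff k := by
  obtain ⟨N, hN⟩ := (hu.mono (hc.uIcc_subset h0 ht)).exists_bound isCompact_uIcc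
  exact coeff_integral_of_bound hN k

theorem CurveContinuousOn.intervalIntegrable (hu : CurveContinuousOn u S) (hc : S.OrdConnected)
    (h0 : (0 : ℝ) ∈ S) {t : ℝ} (ht : t ∈ S) (k : ℤ) :
    IntervalIntegrable (fun s => (u s).coeff k) MeasureTheory.volume 0 t :=
  ((hu.continuousOn_coeff k).mono (hc.uIcc_subset h0 ht)).intervalIntegrable

/-- The fundamental theorem of calculus for curves of Laurent series. -/
theorem CurveContinuousOn.hasCurveDerivAt_integral (hu : CurveContinuousOn u S) (hS : IsOpen S)
    (hc : S.OrdConnected) (h0 : (0 : ℝ) ∈ S) {t : ℝ} (ht : t ∈ S) :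
    HasCurveDerivAt (integral u) (u t) t := by
  obtain ⟨ε, hε, hball⟩ := Metric.nhds_basis_closedBall.mem_iff.1 (hS.mem_nhds ht)
  rw [Real.closedBall_eq_Icc] at hball
  have hle : t - ε ≤ t + ε := by linarith
  have hl : t - ε ∈ S := hball (Set.left_mem_Icc.2 hle)
  have hr : t + ε ∈ S := hball (Set.right_mem_Icc.2 hle)
  -- One compact interval containing `0` and a neighbourhood of `t` bounds all pole orders.
  have hsub : Set.Icc (min 0 (t - ε)) (max 0 (t + ε)) ⊆ S := by
    refine hc.out ?_ ?_
    · rcases min_choice 0 (t - ε) with h | h <;> rw [h] <;> assumption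
    · rcases max_choice 0 (t + ε) with h | h <;> rw [h] <;> assumption
  obtain ⟨N, hN⟩ := (hu.mono hsub).exists_bound isCompact_Icc
  have hnear : ∀ᶠ s in nhds t, s ∈ Set.Icc (t - ε) (t + ε) :=
    Icc_mem_nhds (by linarith) (by linarith)
  have hcoeff : ∀ s ∈ Set.Icc (t - ε) (t + ε), ∀ k,
      (integral u s).coeff k = ∫ r in (0 : ℝ)..s, (u r).coeff k := fun s hs k =>
    hu.coeff_integral hc h0 (hball hs) k
  refine ⟨⟨N, ?_⟩, fun k => ?_⟩
  · rw [nhdsWithin_univ]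
    filter_upwards [hnear] with s hs k hk
    rw [hcoeff s hs, intervalIntegral.integral_congr (g := fun _ => (0 : ℂ)),
      intervalIntegral.integral_zero]
    intro r hr
    refine hN r ⟨le_trans (le_min (min_le_left _ _) ?_) hr.1,
      le_trans hr.2 (max_le (le_max_left _ _) ?_)⟩ k hk
    · exact (min_le_right _ _).trans hs.1
    · exact hs.2.trans (le_max_right _ _)
  · refine HasDerivAt.congr_of_eventuallyEq ?_ (hnear.mono fun s hs => hcoeff s hs k)
    exact intervalIntegral.integral_hasDerivAt_right (hu.intervalIntegrable hc h0 ht k)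
      ((hu.continuousOn_coeff k).stronglyMeasurableAtFilter hS t ht)
      ((hu.continuousOn_coeff k).continuousAt (hS.mem_nhds ht))

theorem integral_zero_right (u : ℝ → Laurent) : integral u 0 = 0 := by
  obtain ⟨N, hN⟩ := exists_coeff_eq_zero_of_lt (u 0)
  ext k
  rw [coeff_integral_of_bound (N := N), intervalIntegral.integral_same, coeff_zero]
  simpa using hN

open Classical in
/-- Integration from `0` as a linear endomorphism of the algebra of curves continuous on an open
interval `S` around `0`; the primitive is set to `0` outside `S`. -/
def primitive (hS : IsOpen S) (hc : S.OrdConnected) (h0 : (0 : ℝ) ∈ S) :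
    contCurves S →ₗ[ℂ] contCurves S where
  toFun u := ⟨fun t => if t ∈ S then integral u.1 t else 0,
    (curveContinuousOn_of_hasCurveDerivAt fun _ ht =>
      CurveContinuousOn.hasCurveDerivAt_integral u.2 hS hc h0 ht).congr fun _ ht => if_pos ht⟩
  map_add' u v := by
    refine Subtype.ext (funext fun t => ?_)
    by_cases ht : t ∈ S
    · change (if t ∈ S then integral (u + v).1 t else 0) =
        (if t ∈ S then integral u.1 t else 0) + (if t ∈ S then integral v.1 t else 0)
      simp only [if_pos ht]
      ext k
      rw [coeff_add, CurveContinuousOn.coeff_integral u.2 hc h0 ht,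
        CurveContinuousOn.coeff_integral v.2 hc h0 ht,
        CurveContinuousOn.coeff_integral (u + v).2 hc h0 ht,
        ← intervalIntegral.integral_add (CurveContinuousOn.intervalIntegrable u.2 hc h0 ht k)
          (CurveContinuousOn.intervalIntegrable v.2 hc h0 ht k)]
      rfl
    · change (if t ∈ S then integral (u + v).1 t else 0) =
        (if t ∈ S then integral u.1 t else 0) + (if t ∈ S then integral v.1 t else 0)
      simp only [if_neg ht, add_zero]
  map_smul' c u := by
    refine Subtype.ext (funext fun t => ?_)
    change (if t ∈ S then integral (c • u).1 t else 0) = c • (if t ∈ S then integral u.1 t else 0)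
    by_cases ht : t ∈ S
    · simp only [if_pos ht]
      ext k
      rw [coeff_smul, CurveContinuousOn.coeff_integral u.2 hc h0 ht,
        CurveContinuousOn.coeff_integral (c • u).2 hc h0 ht,
        ← intervalIntegral.integral_const_mul]
      rfl
    · simp only [if_neg ht, smul_zero]

theorem primitive_apply (hS : IsOpen S) (hc : S.OrdConnected) (h0 : (0 : ℝ) ∈ S)
    (u : contCurves S) {t : ℝ} (ht : t ∈ S) :
    (primitive hS hc h0 u : ℝ → Laurent) t = integral u t := if_pos ht

end Laurent

/-! ### Convolution over a graded coalgebra -/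

section Convolution

variable {C : Type*} [AddCommMonoid C] [Module ℂ C]
variable {𝓑 : Type*} [CommRing 𝓑] [Algebra ℂ 𝓑]

theorem conv_ext {A B : WithConv (C →ₗ[ℂ] 𝓑)} (h : ∀ x, A x = B x) : A = B :=
  WithConv.ext (LinearMap.ext h)

theorem conv_add_apply (A B : WithConv (C →ₗ[ℂ] 𝓑)) (x : C) : (A + B) x = A x + B x := rfl

theorem conv_sub_apply (A B : WithConv (C →ₗ[ℂ] 𝓑)) (x : C) : (A - B) x = A x - B x := rfl

theorem conv_neg_apply (A : WithConv (C →ₗ[ℂ] 𝓑)) (x : C) : (-A) x = -A x := rfl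

theorem conv_smul_apply (c : ℂ) (A : WithConv (C →ₗ[ℂ] 𝓑)) (x : C) : (c • A) x = c • A x := rfl

theorem conv_sum_apply {ι : Type*} (s : Finset ι) (A : ι → WithConv (C →ₗ[ℂ] 𝓑)) (x : C) :
    (∑ i ∈ s, A i) x = ∑ i ∈ s, A i x := by
  change (∑ i ∈ s, A i).ofConv x = _
  rw [WithConv.ofConv_sum, LinearMap.sum_apply]

variable [Coalgebra ℂ C]

/-- A family of subspaces spanning the coalgebra `C`, for which the coproduct is homogeneous of
degree `0`. Independence of the subspaces is not required. -/
structure IsGradedCoalgebra (F : ℕ → Submodule ℂ C) : Prop where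
  iSup_eq_top : ⨆ n, F n = ⊤
  comul_mem : ∀ n, ∀ x ∈ F n, Coalgebra.comul (R := ℂ) x ∈
    ⨆ p ∈ Finset.HasAntidiagonal.antidiagonal n,
      Submodule.map₂ (TensorProduct.mk ℂ C C) (F p.1) (F p.2)

/-- If all products `A x * B y` lie in a subspace, so do the values of `A ⋆ B`. -/
theorem conv_mul_mem (W : Submodule ℂ 𝓑) {A B : WithConv (C →ₗ[ℂ] 𝓑)}
    (h : ∀ x y, A x * B y ∈ W) (x : C) : (A * B) x ∈ W := by
  rw [LinearMap.convMul_apply]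
  induction Coalgebra.comul (R := ℂ) x using TensorProduct.induction_on with
  | zero => simp
  | tmul y z => exact h y z
  | add y z hy hz => rw [map_add, map_add]; exact W.add_mem hy hz

namespace IsGradedCoalgebra

variable {F : ℕ → Submodule ℂ C} (hF : IsGradedCoalgebra F)
include hF

theorem eq_of_forall {A B : WithConv (C →ₗ[ℂ] 𝓑)} (h : ∀ n, ∀ x ∈ F n, A x = B x) : A = B := by
  refine conv_ext fun x => ?_
  have hx : x ∈ ⨆ n, F n := hF.iSup_eq_top ▸ Submodule.mem_top
  have hle : ⨆ n, F n ≤ LinearMap.eqLocus A.ofConv B.ofConv := iSup_le fun n x hx => h n x hx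
  exact hle hx

theorem mul_apply_eq_zero {A B : WithConv (C →ₗ[ℂ] 𝓑)} {n : ℕ}
    (h : ∀ p q, p + q = n → (∀ x ∈ F p, A x = 0) ∨ (∀ x ∈ F q, B x = 0)) {x : C} (hx : x ∈ F n) :
    (A * B) x = 0 := by
  rw [LinearMap.convMul_apply]
  have hle : ⨆ p ∈ Finset.HasAntidiagonal.antidiagonal n,
      Submodule.map₂ (TensorProduct.mk ℂ C C) (F p.1) (F p.2) ≤
        LinearMap.ker (LinearMap.mul' ℂ 𝓑 ∘ₗ TensorProduct.map A.ofConv B.ofConv) := by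
    refine iSup₂_le fun p hp => Submodule.map₂_le.2 fun y hy z hz => ?_
    change A y * B z = 0
    rcases h p.1 p.2 (Finset.HasAntidiagonal.mem_antidiagonal.1 hp) with h | h
    · rw [h y hy, zero_mul]
    · rw [h z hz, mul_zero]
  exact hle (hF.comul_mem n x hx)

/-- If `A` kills the degree `0` part, the values of `D ⋆ A` in degree `n` only depend on `D` in
degrees less than `n`. -/
theorem mul_apply_congr_left {A D D' : WithConv (C →ₗ[ℂ] 𝓑)} {n : ℕ}
    (hA : ∀ x ∈ F 0, A x = 0) (h : ∀ m < n, ∀ x ∈ F m, D x = D' x) {x : C} (hx : x ∈ F n) :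
    (D * A) x = (D' * A) x := by
  rw [← sub_eq_zero, ← conv_sub_apply, ← sub_mul]
  refine hF.mul_apply_eq_zero (fun p q hpq => ?_) hx
  rcases Nat.eq_zero_or_pos q with rfl | hq
  · exact Or.inr hA
  · exact Or.inl fun y hy => sub_eq_zero.2 (h p (by omega) y hy)

theorem mul_apply_congr_right {A D D' : WithConv (C →ₗ[ℂ] 𝓑)} {n : ℕ}
    (hA : ∀ x ∈ F 0, A x = 0) (h : ∀ m < n, ∀ x ∈ F m, D x = D' x) {x : C} (hx : x ∈ F n) :
    (A * D) x = (A * D') x := by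
  rw [← sub_eq_zero, ← conv_sub_apply, ← mul_sub]
  refine hF.mul_apply_eq_zero (fun p q hpq => ?_) hx
  rcases Nat.eq_zero_or_pos p with rfl | hp
  · exact Or.inl hA
  · exact Or.inr fun y hy => sub_eq_zero.2 (h q (by omega) y hy)

/-- The equation `K = B + T ∘ (K ⋆ A)` has at most one solution if `A` kills the degree `0` part. -/
theorem eq_of_fixedPoint {A B K K' : WithConv (C →ₗ[ℂ] 𝓑)} (T : 𝓑 →ₗ[ℂ] 𝓑)
    (hA : ∀ x ∈ F 0, A x = 0) (hK : ∀ x, K x = B x + T ((K * A) x))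
    (hK' : ∀ x, K' x = B x + T ((K' * A) x)) : K = K' := by
  refine hF.eq_of_forall fun n => ?_
  induction n using Nat.strong_induction_on with
  | _ n ih =>
    intro x hx
    rw [hK, hK', hF.mul_apply_congr_left hA ih hx]

theorem pow_apply_eq_zero {A : WithConv (C →ₗ[ℂ] 𝓑)} (hA : ∀ x ∈ F 0, A x = 0) {i n : ℕ}
    (hi : n < i) {x : C} (hx : x ∈ F n) : (A ^ i) x = 0 := by
  induction i generalizing n x with
  | zero => omega
  | succ i ih =>
    rw [pow_succ]
    refine hF.mul_apply_eq_zero (fun p q hpq => ?_) hx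
    rcases Nat.eq_zero_or_pos q with rfl | hq
    · exact Or.inr hA
    · exact Or.inl fun y hy => ih (by omega) hy

end IsGradedCoalgebra

end Convolution

/-! ### Locally finite sums -/

section LocallyFinite

variable {V : Type*} [AddCommGroup V] [Module ℂ V] (F : ℕ → Submodule ℂ V)
  [DirectSum.Decomposition F] {W : Type*} [AddCommGroup W] [Module ℂ W]

/-- The sum of a sequence of linear maps `a i`, of which only those with `i ≤ n` are used in
degree `n`. -/
def locSum (a : ℕ → V →ₗ[ℂ] W) : V →ₗ[ℂ] W :=
  DirectSum.toModule ℂ ℕ W (fun n => (∑ i ∈ Finset.range (n + 1), a i) ∘ₗ (F n).subtype) ∘ₗ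
    (DirectSum.decomposeLinearEquiv F).toLinearMap

theorem locSum_apply {a : ℕ → V →ₗ[ℂ] W} {n N : ℕ} {x : V} (hx : x ∈ F n)
    (ha : ∀ i, n < i → a i x = 0) (hN : n < N) :
    locSum F a x = ∑ i ∈ Finset.range N, a i x := by
  have h1 : locSum F a x = ∑ i ∈ Finset.range (n + 1), a i x := by
    rw [locSum, LinearMap.comp_apply, LinearEquiv.coe_coe, DirectSum.decomposeLinearEquiv_apply,
      DirectSum.decompose_of_mem F hx]
    erw [DirectSum.toModule_lof]
    simp
  rw [h1]
  refine Finset.sum_subset (Finset.range_subset_range.2 hN) fun i _ hi => ha i ?_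
  simpa using hi

end LocallyFinite

section FixedPoint

variable {C : Type*} [AddCommGroup C] [Module ℂ C] [Coalgebra ℂ C]
variable {𝓑 : Type*} [CommRing 𝓑] [Algebra ℂ 𝓑]

/-- The equation `K = B + T ∘ (K ⋆ A)` is solvable if `A` kills the degree `0` part: iterating
`K ↦ T ∘ (K ⋆ A)` on `B` gives a locally finite series. -/
theorem IsGradedCoalgebra.exists_fixedPoint {F : ℕ → Submodule ℂ C} [DirectSum.Decomposition F]
    (hF : IsGradedCoalgebra F) {A : WithConv (C →ₗ[ℂ] 𝓑)} (hA : ∀ x ∈ F 0, A x = 0)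
    (B : WithConv (C →ₗ[ℂ] 𝓑)) (T : 𝓑 →ₗ[ℂ] 𝓑) :
    ∃ K : WithConv (C →ₗ[ℂ] 𝓑), ∀ x, K x = B x + T ((K * A) x) := by
  let a : ℕ → WithConv (C →ₗ[ℂ] 𝓑) := fun i =>
    (fun K => WithConv.toConv (T ∘ₗ (K * A).ofConv))^[i] B
  have a_succ : ∀ i x, a (i + 1) x = T ((a i * A) x) := fun i x => by
    simp only [a, Function.iterate_succ_apply']
    rfl
  have a_zero : ∀ i n, n < i → ∀ x ∈ F n, a i x = 0 := by
    intro i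
    induction i with
    | zero => intro n hn; omega
    | succ i ih =>
      intro n hn x hx
      rw [a_succ, hF.mul_apply_eq_zero (fun p q hpq => ?_) hx, map_zero]
      rcases Nat.eq_zero_or_pos q with rfl | hq
      · exact Or.inr hA
      · exact Or.inl (ih p (by omega))
  let K : WithConv (C →ₗ[ℂ] 𝓑) := WithConv.toConv (locSum F fun i => (a i).ofConv)
  have hK : ∀ n N, n < N → ∀ x ∈ F n, K x = ∑ i ∈ Finset.range N, a i x := fun n N hN x hx =>
    locSum_apply F hx (fun i hi => a_zero i n hi x hx) hN
  refine ⟨K, LinearMap.congr_fun (congrArg WithConv.ofConv (hF.eq_of_forall (A := K)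
    (B := B + WithConv.toConv (T ∘ₗ (K * A).ofConv)) fun n x hx => ?_))⟩
  have h1 : (K * A) x = ((∑ i ∈ Finset.range n, a i) * A) x := by
    refine hF.mul_apply_congr_left hA (fun m hm y hy => ?_) hx
    rw [hK m n hm y hy, conv_sum_apply]
  rw [hK n (n + 1) (Nat.lt_succ_self n) x hx, Finset.sum_range_succ', add_comm]
  change B x + _ = B x + T ((K * A) x)
  rw [h1, Finset.sum_mul, conv_sum_apply, map_sum]
  exact congrArg _ (Finset.sum_congr rfl fun i _ => a_succ i x)

end FixedPoint

/-! ### The grading of `H ⊗ H` -/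

section TensorSquare

variable {H : Type*} [CommRing H] [HopfAlgebra ℂ H]

/-- The total grading of `H ⊗ H`. -/
def tensorDeg (F : ℕ → Submodule ℂ H) (n : ℕ) : Submodule ℂ (H ⊗[ℂ] H) :=
  ⨆ p ∈ Finset.HasAntidiagonal.antidiagonal n,
    Submodule.map₂ (TensorProduct.mk ℂ H H) (F p.1) (F p.2)

theorem tmul_mem_tensorDeg {F : ℕ → Submodule ℂ H} {p q n : ℕ} (h : p + q = n) {x y : H}
    (hx : x ∈ F p) (hy : y ∈ F q) : x ⊗ₜ[ℂ] y ∈ tensorDeg F n :=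
  Submodule.mem_iSup_of_mem (p, q) (Submodule.mem_iSup_of_mem
    (Finset.HasAntidiagonal.mem_antidiagonal.2 h) (Submodule.apply_mem_map₂ _ hx hy))

theorem tensorDeg_le {F : ℕ → Submodule ℂ H} {n : ℕ} {W : Submodule ℂ (H ⊗[ℂ] H)}
    (h : ∀ p q, p + q = n → ∀ x ∈ F p, ∀ y ∈ F q, x ⊗ₜ[ℂ] y ∈ W) : tensorDeg F n ≤ W :=
  iSup₂_le fun p hp => Submodule.map₂_le.2 fun x hx y hy =>
    h p.1 p.2 (Finset.HasAntidiagonal.mem_antidiagonal.1 hp) x hx y hy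

theorem IsGradedCoalgebra.tensorSquare {F : ℕ → Submodule ℂ H} (hF : IsGradedCoalgebra F) :
    IsGradedCoalgebra (tensorDeg F) where
  iSup_eq_top := by
    rw [eq_top_iff, ← TensorProduct.map₂_mk_top_top_eq_top, ← hF.iSup_eq_top,
      Submodule.map₂_iSup_left]
    refine iSup_le fun p => ?_
    rw [Submodule.map₂_iSup_right]
    exact iSup_le fun q => Submodule.map₂_le.2 fun x hx y hy =>
      Submodule.mem_iSup_of_mem (p + q) (tmul_mem_tensorDeg rfl hx hy)
  comul_mem n z hz := by
    set G : Submodule ℂ ((H ⊗[ℂ] H) ⊗[ℂ] (H ⊗[ℂ] H)) :=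
      ⨆ p ∈ Finset.HasAntidiagonal.antidiagonal n,
        Submodule.map₂ (TensorProduct.mk ℂ (H ⊗[ℂ] H) (H ⊗[ℂ] H))
          (tensorDeg F p.1) (tensorDeg F p.2) with hG
    have hle : tensorDeg F n ≤ G.comap (Coalgebra.comul (R := ℂ) (A := H ⊗[ℂ] H)) := by
      refine tensorDeg_le fun p q hpq x hx y hy => ?_
      have hx' : Coalgebra.comul (R := ℂ) x ∈ tensorDeg F p := hF.comul_mem p x hx
      have hy' : Coalgebra.comul (R := ℂ) y ∈ tensorDeg F q := hF.comul_mem q y hy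
      rw [Submodule.mem_comap, TensorProduct.comul_tmul]
      generalize Coalgebra.comul (R := ℂ) x = a at hx'
      generalize Coalgebra.comul (R := ℂ) y = b at hy'
      -- It suffices to treat pure tensors `a = a₁ ⊗ a₂` and `b = b₁ ⊗ b₂`.
      let Ψ : (H ⊗[ℂ] H) ⊗[ℂ] (H ⊗[ℂ] H) →ₗ[ℂ] (H ⊗[ℂ] H) ⊗[ℂ] (H ⊗[ℂ] H) :=
        (TensorProduct.AlgebraTensorModule.tensorTensorTensorComm ℂ ℂ ℂ ℂ H H H H).toLinearMap
      change Ψ (a ⊗ₜ[ℂ] b) ∈ G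
      have h1 : tensorDeg F p ≤ G.comap (Ψ ∘ₗ (TensorProduct.mk ℂ _ _).flip b) := by
        refine tensorDeg_le fun i j hij a₁ ha₁ a₂ ha₂ => ?_
        have h2 : tensorDeg F q ≤ G.comap (Ψ ∘ₗ TensorProduct.mk ℂ _ _ (a₁ ⊗ₜ[ℂ] a₂)) := by
          refine tensorDeg_le fun k l hkl b₁ hb₁ b₂ hb₂ => ?_
          change (a₁ ⊗ₜ[ℂ] b₁) ⊗ₜ[ℂ] (a₂ ⊗ₜ[ℂ] b₂) ∈ G
          refine Submodule.mem_iSup_of_mem (i + k, j + l) (Submodule.mem_iSup_of_mem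
            (Finset.HasAntidiagonal.mem_antidiagonal.2 (by omega))
            (Submodule.apply_mem_map₂ _ ?_ ?_))
          · exact tmul_mem_tensorDeg rfl ha₁ hb₁
          · exact tmul_mem_tensorDeg rfl ha₂ hb₂
        exact h2 hy'
      exact h1 hx'
    exact hle hz

end TensorSquare

theorem IsConnectedGraded.isGradedCoalgebra {H : Type*} [CommRing H] [HopfAlgebra ℂ H]
    {Hdeg : ℕ → Submodule ℂ H} [GradedAlgebra Hdeg] (hH : IsConnectedGraded Hdeg) :
    IsGradedCoalgebra Hdeg where
  iSup_eq_top := (DirectSum.Decomposition.isInternal Hdeg).submodule_iSup_eq_top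
  comul_mem n x hx := by
    have h := hH.comul_mem n x hx
    simpa only [TensorProduct.map₂_eq_range_lift_comp_mapIncl, TensorProduct.mapIncl,
      TensorProduct.lift_mk, LinearMap.id_comp] using h

/-! ### Curves in the convolution algebra -/

section ConvCurves

variable {C C' : Type*} [AddCommMonoid C] [Module ℂ C] [AddCommMonoid C'] [Module ℂ C']

/-- The curve `K` of linear maps has derivative `K'` at `t` in the topology of pointwise
convergence. -/
def HasConvDerivAt (K : ℝ → WithConv (C →ₗ[ℂ] Laurent)) (K' : WithConv (C →ₗ[ℂ] Laurent))
    (t : ℝ) : Prop :=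
  ∀ x, Laurent.HasCurveDerivAt (fun s => K s x) (K' x) t

variable {K L : ℝ → WithConv (C →ₗ[ℂ] Laurent)} {K' L' : WithConv (C →ₗ[ℂ] Laurent)} {t : ℝ}

theorem hasConvDerivAt_const (A : WithConv (C →ₗ[ℂ] Laurent)) (t : ℝ) :
    HasConvDerivAt (fun _ => A) 0 t := fun _ => Laurent.hasCurveDerivAt_const _ t

theorem HasConvDerivAt.unique (h : HasConvDerivAt K K' t) (h' : HasConvDerivAt K L' t) : K' = L' :=
  conv_ext fun x => (h x).unique (h' x)

theorem HasConvDerivAt.congr_deriv (h : HasConvDerivAt K K' t) (h' : K' = L') :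
    HasConvDerivAt K L' t := h' ▸ h

theorem HasConvDerivAt.congr {S : Set ℝ} (hS : IsOpen S) (ht : t ∈ S) (h : HasConvDerivAt K K' t)
    (hKL : ∀ s ∈ S, L s = K s) : HasConvDerivAt L K' t := fun x =>
  (h x).congr hS ht fun s hs => by rw [hKL s hs]

/-- Precomposition with a linear map. -/
theorem HasConvDerivAt.comp (h : HasConvDerivAt K K' t) (f : C' →ₗ[ℂ] C) :
    HasConvDerivAt (fun s => WithConv.toConv ((K s).ofConv ∘ₗ f))
      (WithConv.toConv (K'.ofConv ∘ₗ f)) t := fun x => h (f x)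

theorem exists_hasConvDerivAt
    (h : ∀ x, ∃ a, Laurent.HasCurveDerivAt (fun s => K s x) a t) : ∃ K', HasConvDerivAt K K' t := by
  choose a ha using h
  refine ⟨WithConv.toConv ⟨⟨a, fun x y => ?_⟩, fun c x => ?_⟩, ha⟩
  · refine (ha (x + y)).unique ?_
    simpa only [map_add] using (ha x).add (ha y)
  · refine (ha (c • x)).unique ?_
    simpa only [map_smul, RingHom.id_apply] using (ha x).const_smul c

/-- The Leibniz rule, on an arbitrary tensor. -/
theorem HasConvDerivAt.mul_map {L : ℝ → WithConv (C' →ₗ[ℂ] Laurent)}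
    {L' : WithConv (C' →ₗ[ℂ] Laurent)} (hK : HasConvDerivAt K K' t) (hL : HasConvDerivAt L L' t)
    (z : C ⊗[ℂ] C') : Laurent.HasCurveDerivAt
      (fun s => LinearMap.mul' ℂ Laurent (TensorProduct.map (K s).ofConv (L s).ofConv z))
      (LinearMap.mul' ℂ Laurent (TensorProduct.map K'.ofConv (L t).ofConv z) +
        LinearMap.mul' ℂ Laurent (TensorProduct.map (K t).ofConv L'.ofConv z)) t := by
  induction z using TensorProduct.induction_on with
  | zero => simpa only [map_zero, add_zero] using Laurent.hasCurveDerivAt_const 0 t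
  | tmul x y => exact (hK x).mul (hL y)
  | add y z hy hz =>
    simp only [map_add]
    rw [add_add_add_comm]
    exact hy.add hz

variable [Coalgebra ℂ C]

theorem HasConvDerivAt.mul (hK : HasConvDerivAt K K' t) (hL : HasConvDerivAt L L' t) :
    HasConvDerivAt (fun s => K s * L s) (K' * L t + K t * L') t := fun x =>
  hK.mul_map hL (Coalgebra.comul (R := ℂ) x)

/-- Uniqueness for triangular differential equations: the derivative in degree `n` is determined by
the curve in degrees less than `n`. -/
theorem IsGradedCoalgebra.eq_of_triangular {F : ℕ → Submodule ℂ C} (hF : IsGradedCoalgebra F)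
    {S : Set ℝ} (hS : IsOpen S) (hc : S.OrdConnected) (h0 : (0 : ℝ) ∈ S)
    {G M : ℝ → WithConv (C →ₗ[ℂ] Laurent)} (hinit : K 0 = L 0)
    (hK : ∀ t ∈ S, HasConvDerivAt K (G t) t) (hL : ∀ t ∈ S, HasConvDerivAt L (M t) t)
    (h : ∀ n, (∀ m < n, ∀ x ∈ F m, ∀ t ∈ S, K t x = L t x) →
      ∀ x ∈ F n, ∀ t ∈ S, G t x = M t x) :
    ∀ t ∈ S, K t = L t := by
  have key : ∀ n, ∀ x ∈ F n, ∀ t ∈ S, K t x = L t x := by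
    intro n
    induction n using Nat.strong_induction_on with
    | _ n ih =>
      intro x hx t ht
      have hd : ∀ s ∈ S, Laurent.HasCurveDerivAt (fun s => K s x - L s x) 0 s := fun s hs => by
        have := (hK s hs x).sub (hL s hs x)
        rwa [h n ih x hx s hs, sub_self] at this
      have := Laurent.eq_of_hasCurveDerivAt_zero hS hc hd ht h0
      rwa [hinit, sub_self, sub_eq_zero] at this
  exact fun t ht => hF.eq_of_forall fun n x hx => key n x hx t ht

end ConvCurves

/-! ### Characters and infinitesimal characters -/

section Characters

variable {H : Type*} [CommRing H] [HopfAlgebra ℂ H]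

theorem IsInfChar.apply_one {Z : Conv H} (hZ : IsInfChar Z) : Z 1 = 0 := by
  have h := hZ 1 1
  rw [Bialgebra.counit_one, RingHom.map_one, mul_one, mul_one, one_mul] at h
  exact left_eq_add.1 h

theorem IsConnectedGraded.apply_eq_zero {Hdeg : ℕ → Submodule ℂ H} [GradedAlgebra Hdeg]
    (hH : IsConnectedGraded Hdeg) {𝓑 : Type*} [AddCommMonoid 𝓑] [Module ℂ 𝓑]
    {A : WithConv (H →ₗ[ℂ] 𝓑)} (hA : A 1 = 0) : ∀ x ∈ Hdeg 0, A x = 0 := fun x hx => by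
  rw [hH.connected, Submodule.mem_span_singleton] at hx
  obtain ⟨c, rfl⟩ := hx
  rw [map_smul, hA, smul_zero]

theorem conv_mul_apply_one {𝓑 : Type*} [CommRing 𝓑] [Algebra ℂ 𝓑] (A B : WithConv (H →ₗ[ℂ] 𝓑)) :
    (A * B) 1 = A 1 * B 1 := by
  rw [LinearMap.convMul_apply, Bialgebra.comul_one]
  rfl

theorem exists_char_of_mul {K : Conv H} (h1 : K 1 = 1) (h : mulPull K = tens K K) :
    ∃ g : CharGroup H, toConvLin g = K :=
  ⟨WithConv.toConv (AlgHom.ofLinearMap K.ofConv h1 fun x y =>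
    congrArg (fun F : WithConv (H ⊗[ℂ] H →ₗ[ℂ] Laurent) => F (x ⊗ₜ[ℂ] y)) h), rfl⟩

theorem mulPull_one : mulPull (1 : Conv H) = tens 1 1 := by
  rw [← toConvLin_one, mulPull_toConvLin]

/-- A solution of `K' = K ⋆ A`, `K(0) = 1` consists of characters if `A` consists of infinitesimal
characters: both `K(xy)` and `K(x) K(y)` solve the same equation on `H ⊗ H`. -/
theorem exists_char_of_hasConvDerivAt {Hdeg : ℕ → Submodule ℂ H} [GradedAlgebra Hdeg]
    (hH : IsConnectedGraded Hdeg) {S : Set ℝ} (hS : IsOpen S) (hc : S.OrdConnected)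
    (h0 : (0 : ℝ) ∈ S) {K A : ℝ → Conv H} (hA : ∀ t ∈ S, IsInfChar (A t)) (hinit : K 0 = 1)
    (hK : ∀ t ∈ S, HasConvDerivAt K (K t * A t) t) {t : ℝ} (ht : t ∈ S) :
    ∃ g : CharGroup H, toConvLin g = K t := by
  refine exists_char_of_mul ?_ ?_
  · have h := Laurent.eq_of_hasCurveDerivAt_zero (u := fun s => K s 1) hS hc (fun s hs => by
      have := hK s hs 1
      rwa [conv_mul_apply_one, (hA s hs).apply_one, mul_zero] at this) ht h0
    rw [h, hinit, LinearMap.convOne_apply, Bialgebra.counit_one, map_one]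
  · have hF := hH.isGradedCoalgebra.tensorSquare
    refine hF.eq_of_triangular (K := fun s => mulPull (K s)) (L := fun s => tens (K s) (K s))
      (G := fun s => mulPull (K s) * (tens (A s) 1 + tens 1 (A s)))
      (M := fun s => tens (K s) (K s) * (tens (A s) 1 + tens 1 (A s))) hS hc h0 ?_
      (fun s hs => ?_) (fun s hs => ?_) (fun n hn x hx s hs => ?_) t ht
    · simp only [hinit, mulPull_one]
    · rw [← (isInfChar_iff _).1 (hA s hs), ← mulPull_mul]
      exact (hK s hs).comp _
    · rw [mul_add, tens_mul, tens_mul, mul_one]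
      exact fun z => (hK s hs).mul_map (hK s hs) z
    · refine hF.mul_apply_congr_left (fun z hz => ?_) (fun m hm y hy => hn m hm y hy s hs) hx
      rw [← (isInfChar_iff _).1 (hA s hs)]
      have hle : tensorDeg Hdeg 0 ≤ LinearMap.ker (mulPull (A s)).ofConv := by
        refine tensorDeg_le fun p q hpq x hx y hy => ?_
        obtain ⟨rfl, rfl⟩ : p = 0 ∧ q = 0 := by omega
        change A s (x * y) = 0
        have h00 := hH.apply_eq_zero (hA s hs).apply_one
        rw [hA s hs x y, h00 x hx, h00 y hy, zero_mul, mul_zero, add_zero]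
      exact hle hz

theorem toConvLin_inv_mul (g : CharGroup H) : toConvLin g⁻¹ * toConvLin g = 1 := by
  rw [← toConvLin_mul, inv_mul_cancel, toConvLin_one]

theorem toConvLin_mul_inv (g : CharGroup H) : toConvLin g * toConvLin g⁻¹ = 1 := by
  rw [← toConvLin_mul, mul_inv_cancel, toConvLin_one]

theorem Ad_coe (g : CharGroup H) (Z : infChar H) :
    ((Ad g Z : infChar H) : Conv H) = toConvLin g * (Z : Conv H) * toConvLin g⁻¹ := rfl

theorem lie_coe (Z W : infChar H) :
    ((⁅Z, W⁆ : infChar H) : Conv H) = (Z : Conv H) * W - W * Z := rfl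

/-- Inverses of a differentiable curve of characters are differentiable, being given by composition
with the antipode. -/
theorem HasConvDerivAt.inv {g : ℝ → CharGroup H} {D : Conv H} {t : ℝ}
    (h : HasConvDerivAt (fun s => toConvLin (g s)) D t) :
    HasConvDerivAt (fun s => toConvLin (g s)⁻¹) (-(toConvLin (g t)⁻¹ * D * toConvLin (g t)⁻¹)) t := by
  obtain ⟨E, hE⟩ : ∃ E, HasConvDerivAt (fun s => toConvLin (g s)⁻¹) E t :=
    ⟨_, h.comp (HopfAlgebra.antipode ℂ (A := H))⟩
  have h1 : HasConvDerivAt (fun s => toConvLin (g s)⁻¹ * toConvLin (g s)) 0 t := by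
    simp only [toConvLin_inv_mul]
    exact hasConvDerivAt_const 1 t
  have h2 := (hE.mul h).unique h1
  refine hE.congr_deriv ?_
  rw [← mul_one E, ← toConvLin_mul_inv (g t), ← mul_assoc, eq_neg_of_add_eq_zero_left h2, neg_mul]

/-- Conjugating by a curve of characters with `g' = g ⋆ G`: `(g⁻¹ ⋆ Z ⋆ g)' = [g⁻¹ ⋆ Z ⋆ g, G]`. -/
theorem HasConvDerivAt.conj {g : ℝ → CharGroup H} {G : Conv H} {t : ℝ} (Z : Conv H)
    (h : HasConvDerivAt (fun s => toConvLin (g s)) (toConvLin (g t) * G) t) :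
    HasConvDerivAt (fun s => toConvLin (g s)⁻¹ * Z * toConvLin (g s))
      (toConvLin (g t)⁻¹ * Z * toConvLin (g t) * G -
        G * (toConvLin (g t)⁻¹ * Z * toConvLin (g t))) t := by
  refine ((h.inv.mul (hasConvDerivAt_const Z t)).mul h).congr_deriv ?_
  have h1 : toConvLin (g t)⁻¹ * (toConvLin (g t) * G) = G := by
    rw [← mul_assoc, toConvLin_inv_mul, one_mul]
  rw [h1, mul_zero, add_zero]
  noncomm_ring

end Characters

/-! ### The convolution exponential -/

section Exponential

variable {H : Type*} [CommRing H] [HopfAlgebra ℂ H]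

theorem IsGradedCoalgebra.hasConvDerivAt {C : Type*} [AddCommMonoid C] [Module ℂ C]
    [Coalgebra ℂ C] {F : ℕ → Submodule ℂ C} (hF : IsGradedCoalgebra F)
    {K : ℝ → WithConv (C →ₗ[ℂ] Laurent)} {K' : WithConv (C →ₗ[ℂ] Laurent)} {t : ℝ}
    (h : ∀ n, ∀ x ∈ F n, Laurent.HasCurveDerivAt (fun s => K s x) (K' x) t) :
    HasConvDerivAt K K' t := fun x => by
  have hx : x ∈ ⨆ n, F n := hF.iSup_eq_top ▸ Submodule.mem_top
  induction hx using Submodule.iSup_induction' with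
  | mem n x hx => exact h n x hx
  | zero => simpa only [map_zero] using Laurent.hasCurveDerivAt_const 0 t
  | add x y _ _ hx hy => simpa only [map_add] using hx.add hy

variable (Hdeg : ℕ → Submodule ℂ H) [GradedAlgebra Hdeg]

/-- The exponential `∑ n, Z^{⋆n} / n!` for the convolution product, a locally finite sum when
`Z(1) = 0`. -/
def expConv (Z : Conv H) : Conv H :=
  WithConv.toConv (locSum Hdeg fun i => ((i.factorial : ℂ)⁻¹ • Z ^ i : Conv H).ofConv)

variable {Hdeg} (hH : IsConnectedGraded Hdeg)
include hH

theorem expConv_apply {Z : Conv H} (hZ : Z 1 = 0) {n N : ℕ} (hN : n < N) {x : H}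
    (hx : x ∈ Hdeg n) :
    expConv Hdeg Z x = ∑ i ∈ Finset.range N, (i.factorial : ℂ)⁻¹ • (Z ^ i) x := by
  refine locSum_apply Hdeg hx (fun i hi => ?_) hN
  change (i.factorial : ℂ)⁻¹ • (Z ^ i) x = 0
  rw [hH.isGradedCoalgebra.pow_apply_eq_zero (hH.apply_eq_zero hZ) hi hx, smul_zero]

theorem expConv_zero : expConv Hdeg (0 : Conv H) = 1 := by
  refine hH.isGradedCoalgebra.eq_of_forall fun n x hx => ?_
  rw [expConv_apply hH rfl (Nat.lt_succ_self n) hx, Finset.sum_range_succ']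
  simp only [ne_eq, Nat.add_eq_zero_iff, one_ne_zero, and_false, not_false_eq_true, zero_pow,
    pow_zero, Nat.factorial_zero, Nat.cast_one, inv_one, one_smul]
  refine (add_eq_right).2 (Finset.sum_eq_zero fun i _ => ?_)
  exact smul_zero _

theorem isExp_iff {Z : infChar H} {φ : CharGroup H} :
    IsExp Z φ ↔ toConvLin φ = expConv Hdeg (Z : Conv H) := by
  have hZ := IsInfChar.apply_one Z.2
  constructor
  · intro h
    refine hH.isGradedCoalgebra.eq_of_forall fun n x hx => ?_
    obtain ⟨N, hN⟩ := h x
    rw [expConv_apply hH hZ (lt_of_lt_of_le (Nat.lt_succ_self n) (le_max_right N _)) hx]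
    exact (hN _ (le_max_left _ _)).symm
  · intro h x
    have hx : x ∈ ⨆ n, Hdeg n := hH.isGradedCoalgebra.iSup_eq_top ▸ Submodule.mem_top
    induction hx using Submodule.iSup_induction' with
    | mem n x hx =>
      refine ⟨n + 1, fun N hN => ?_⟩
      rw [← expConv_apply hH hZ hN hx, ← h]
      rfl
    | zero => exact ⟨0, fun N _ => by simp⟩
    | add x y _ _ hx hy =>
      obtain ⟨N, hN⟩ := hx
      obtain ⟨N', hN'⟩ := hy
      refine ⟨max N N', fun k hk => ?_⟩
      simp only [map_add, smul_add, Finset.sum_add_distrib]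
      rw [hN k ((le_max_left _ _).trans hk), hN' k ((le_max_right _ _).trans hk)]

theorem expConv_commute {Z W : Conv H} (hZ : Z 1 = 0) (hW : W 1 = 0) (h : Commute Z W) :
    Commute (expConv Hdeg Z) W := by
  refine hH.isGradedCoalgebra.eq_of_forall fun n x hx => ?_
  have key : ∀ m < n, ∀ y ∈ Hdeg m, expConv Hdeg Z y =
      (∑ i ∈ Finset.range n, (i.factorial : ℂ)⁻¹ • Z ^ i : Conv H) y := fun m hm y hy => by
    rw [expConv_apply hH hZ hm hy, conv_sum_apply]
    rfl
  rw [hH.isGradedCoalgebra.mul_apply_congr_left (hH.apply_eq_zero hW) key hx,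
    hH.isGradedCoalgebra.mul_apply_congr_right (hH.apply_eq_zero hW) key hx]
  have hc : Commute (∑ i ∈ Finset.range n, (i.factorial : ℂ)⁻¹ • Z ^ i : Conv H) W :=
    Commute.sum_left _ _ _ fun i _ => (h.pow_left i).smul_left _
  rw [hc.eq]

theorem hasConvDerivAt_expConv {X : Conv H} (hX : X 1 = 0) (t : ℝ) :
    HasConvDerivAt (fun s => expConv Hdeg (-(s : ℂ) • X)) (expConv Hdeg (-(t : ℂ) • X) * -X) t := by
  have h1 : ∀ c : ℂ, (c • X) 1 = 0 := fun c => by rw [conv_smul_apply, hX, smul_zero]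
  refine hH.isGradedCoalgebra.hasConvDerivAt fun n x hx => ?_
  have hexp : ∀ s : ℝ, expConv Hdeg (-(s : ℂ) • X) x =
      ∑ i ∈ Finset.range n, ((((i + 1).factorial : ℂ)⁻¹ * (-(s : ℂ)) ^ (i + 1)) • (X ^ (i + 1)) x) +
        (1 : Conv H) x := fun s => by
    rw [expConv_apply hH (h1 _) (Nat.lt_succ_self n) hx, Finset.sum_range_succ']
    simp only [smul_pow, conv_smul_apply, smul_smul, pow_zero, Nat.factorial_zero, Nat.cast_one,
      inv_one, one_smul]
  have hder : (expConv Hdeg (-(t : ℂ) • X) * -X) x =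
      ∑ i ∈ Finset.range n, (((i.factorial : ℂ)⁻¹ * (-(t : ℂ)) ^ i * -1) • (X ^ (i + 1)) x) + 0 := by
    have h2 : (expConv Hdeg (-(t : ℂ) • X) * -X) x =
        ((∑ i ∈ Finset.range n, (i.factorial : ℂ)⁻¹ • (-(t : ℂ) • X) ^ i) * -X) x := by
      refine hH.isGradedCoalgebra.mul_apply_congr_left
        (hH.apply_eq_zero (by rw [conv_neg_apply, hX, neg_zero])) (fun m hm y hy => ?_) hx
      rw [expConv_apply hH (h1 _) hm hy, conv_sum_apply]
      rfl
    rw [h2, add_zero, Finset.sum_mul, conv_sum_apply]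
    refine Finset.sum_congr rfl fun i _ => ?_
    rw [smul_pow, smul_smul, smul_mul_assoc, mul_neg, ← pow_succ, conv_smul_apply, conv_neg_apply,
      mul_neg_one, neg_smul, smul_neg]
  simp only [hexp]
  rw [hder]
  refine (Laurent.HasCurveDerivAt.sum fun i _ => ?_).add (Laurent.hasCurveDerivAt_const _ t)
  refine Laurent.hasCurveDerivAt_smul_const ?_ _
  have hd : HasDerivAt (fun s : ℝ => -(s : ℂ)) (-1) t := (Complex.ofRealCLM.hasDerivAt (x := t)).neg
  refine ((hd.pow (i + 1)).const_mul (((i + 1).factorial : ℂ)⁻¹)).congr_deriv ?_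
  have hi : (i.factorial : ℂ) ≠ 0 := Nat.cast_ne_zero.2 i.factorial_ne_zero
  have hi' : (i : ℂ) + 1 ≠ 0 := Nat.cast_add_one_ne_zero i
  rw [Nat.factorial_succ]
  push_cast
  field_simp

theorem exists_isExp (X : infChar H) (t : ℝ) : ∃ φ : CharGroup H, IsExp (-(t : ℂ) • X) φ := by
  simp only [isExp_iff hH]
  refine exists_char_of_hasConvDerivAt hH isOpen_univ Set.ordConnected_univ (Set.mem_univ 0)
    (K := fun s => expConv Hdeg (-(s : ℂ) • (X : Conv H))) (A := fun _ => -(X : Conv H))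
    (fun _ _ => (-X).2) ?_ (fun s _ => hasConvDerivAt_expConv hH X.2.apply_one s) (Set.mem_univ t)
  simp only [Complex.ofReal_zero, neg_zero, zero_smul]
  exact expConv_zero hH

end Exponential

/-! ### The Birkhoff factorization -/

section Birkhoff

open Laurent

/-- If `K - ε` takes values in `𝒜₋` and `K ⋆ Φ` in `𝒜₊`, then `K` solves the fixed point equation
of the Birkhoff recursion. -/
theorem fixedPoint_of_polar_of_holo {C : Type*} [AddCommMonoid C] [Module ℂ C] [Coalgebra ℂ C]
    {K Φ : WithConv (C →ₗ[ℂ] Laurent)} (h : ∀ x, (K - 1) x ∈ polar) (h' : ∀ x, (K * Φ) x ∈ holo)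
    (x : C) : K x = (1 : WithConv (C →ₗ[ℂ] Laurent)) x + (-polePart) ((K * (Φ - 1)) x) := by
  have h1 : (1 : WithConv (C →ₗ[ℂ] Laurent)) x ∈ holo := algebraMap_mem_holo _
  have h2 : K x = (K - 1) x + (1 : WithConv (C →ₗ[ℂ] Laurent)) x := by
    rw [conv_sub_apply, sub_add_cancel]
  rw [mul_sub, mul_one, conv_sub_apply, LinearMap.neg_apply, map_sub, polePart_of_mem_holo (h' x),
    zero_sub, neg_neg]
  conv_rhs => rw [h2, map_add, polePart_of_mem_polar (h x), polePart_of_mem_holo h1, add_zero]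
  rw [h2, add_comm]

variable {H : Type*} [CommRing H] [HopfAlgebra ℂ H]

theorem one_eq_tens : (1 : WithConv (H ⊗[ℂ] H →ₗ[ℂ] Laurent)) = tens 1 1 := by
  apply WithConv.ext
  ext x y : 3
  change algebraMap ℂ Laurent (Coalgebra.counit (R := ℂ) (x ⊗ₜ[ℂ] y)) =
    algebraMap ℂ Laurent _ * algebraMap ℂ Laurent _
  rw [TensorProduct.counit_tmul, ← RingHom.map_mul, smul_eq_mul, mul_comm]

theorem char_sub_one_apply_one (φ : CharGroup H) : (toConvLin φ - 1 : Conv H) 1 = 0 := by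
  rw [conv_sub_apply, LinearMap.convOne_apply, Bialgebra.counit_one, RingHom.map_one, sub_eq_zero]
  exact map_one φ.ofConv

theorem IsBirkhoff.mul_eq {φ gm gp : CharGroup H} (h : IsBirkhoff φ gm gp) : gm * φ = gp := by
  rw [h.1, mul_inv_cancel_left]

theorem IsBirkhoff.sub_one_mem {φ gm gp : CharGroup H} (h : IsBirkhoff φ gm gp) (x : H) :
    (toConvLin gm - 1 : Conv H) x ∈ polar := by
  have h1 := h.2.2 (x - algebraMap ℂ H (Coalgebra.counit (R := ℂ) x))
    (by rw [map_sub, Bialgebra.counit_algebraMap, sub_self])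
  have h2 : gm (x - algebraMap ℂ H (Coalgebra.counit (R := ℂ) x)) =
      (toConvLin gm - 1 : Conv H) x :=
    (map_sub gm.ofConv _ _).trans (congrArg _ (gm.ofConv.commutes _))
  rwa [h2] at h1

theorem IsBirkhoff.fixedPoint {φ gm gp : CharGroup H} (h : IsBirkhoff φ gm gp) (x : H) :
    toConvLin gm x = (1 : Conv H) x + (-polePart) ((toConvLin gm * (toConvLin φ - 1)) x) :=
  fixedPoint_of_polar_of_holo h.sub_one_mem
    (by rw [← toConvLin_mul, h.mul_eq]; exact h.2.1) x

variable {Hdeg : ℕ → Submodule ℂ H} [GradedAlgebra Hdeg] (hH : IsConnectedGraded Hdeg)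
include hH

theorem IsBirkhoff.unique {φ gm gp gm' gp' : CharGroup H} (h : IsBirkhoff φ gm gp)
    (h' : IsBirkhoff φ gm' gp') : gm = gm' ∧ gp = gp' := by
  have h1 : gm = gm' := toConvLin_injective (hH.isGradedCoalgebra.eq_of_fixedPoint _
    (hH.apply_eq_zero (char_sub_one_apply_one φ)) h.fixedPoint h'.fixedPoint)
  exact ⟨h1, by rw [← h.mul_eq, ← h'.mul_eq, h1]⟩

/-- Existence of the Birkhoff factorization. The solution `K` of the fixed point equation is
multiplicative because `K(xy)` and `K(x) K(y)` solve the same fixed point equation on `H ⊗ H`. -/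
theorem exists_isBirkhoff (φ : CharGroup H) : ∃ gm gp : CharGroup H, IsBirkhoff φ gm gp := by
  obtain ⟨K, hK⟩ := hH.isGradedCoalgebra.exists_fixedPoint
    (hH.apply_eq_zero (char_sub_one_apply_one φ)) (1 : Conv H) (-polePart)
  have hpolar : ∀ x, (K - 1) x ∈ polar := fun x => by
    rw [conv_sub_apply, hK, add_sub_cancel_left]
    exact polar.neg_mem (polePart_mem_polar _)
  have hholo : ∀ x, (K * toConvLin φ) x ∈ holo := fun x => by
    have h1 : (1 : Conv H) x ∈ holo := algebraMap_mem_holo _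
    have h2 : K * toConvLin φ = K * (toConvLin φ - 1) + (K - 1) + 1 := by noncomm_ring
    have h3 : (K - 1) x = -polePart ((K * (toConvLin φ - 1)) x) := by
      rw [conv_sub_apply, hK, add_sub_cancel_left, LinearMap.neg_apply]
    -- `P₋(K ⋆ φ) = P₋(K ⋆ (φ - ε)) + (K - ε) + P₋(ε)`, and the first two terms cancel.
    refine mem_holo_of_polePart_eq_zero ?_
    rw [h2, conv_add_apply, conv_add_apply, map_add, map_add, polePart_of_mem_polar (hpolar x),
      polePart_of_mem_holo h1, h3, add_zero, add_neg_cancel]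
  have hone : K 1 = 1 := by
    rw [hK, conv_mul_apply_one, char_sub_one_apply_one, mul_zero, map_zero, add_zero,
      LinearMap.convOne_apply, Bialgebra.counit_one, RingHom.map_one]
  have hmul : mulPull K = tens K K := by
    refine hH.isGradedCoalgebra.tensorSquare.eq_of_fixedPoint (-polePart)
      (A := mulPull (toConvLin φ) - 1) ?_
      (fixedPoint_of_polar_of_holo ?_ ?_) (fixedPoint_of_polar_of_holo ?_ ?_)
    · have hle : tensorDeg Hdeg 0 ≤ LinearMap.ker (mulPull (toConvLin φ) - 1).ofConv := by
        refine tensorDeg_le fun p q hpq x hx y hy => ?_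
        obtain ⟨rfl, rfl⟩ : p = 0 ∧ q = 0 := by omega
        have h00 := hH.apply_eq_zero (char_sub_one_apply_one φ)
        rw [LinearMap.mem_ker, one_eq_tens, mulPull_toConvLin]
        have h11 : ∀ x ∈ Hdeg 0, toConvLin φ x = (1 : Conv H) x := fun x hx =>
          sub_eq_zero.1 (h00 x hx)
        change toConvLin φ x * toConvLin φ y - (1 : Conv H) x * (1 : Conv H) y = 0
        rw [h11 x hx, h11 y hy, sub_self]
      exact fun z hz => hle hz
    · intro z
      rw [one_eq_tens, ← mulPull_one]
      exact hpolar _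
    · intro z
      rw [← mulPull_mul]
      exact hholo _
    · intro z
      rw [one_eq_tens]
      induction z using TensorProduct.induction_on with
      | zero => rw [map_zero]; exact polar.zero_mem
      | tmul x y =>
        change K x * K y - (1 : Conv H) x * (1 : Conv H) y ∈ polar
        have h1 : K x * K y - (1 : Conv H) x * (1 : Conv H) y =
            (K - 1) x * (K - 1) y + (K - 1) x * (1 : Conv H) y + (K - 1) y * (1 : Conv H) x := by
          simp only [conv_sub_apply]
          ring
        rw [h1]
        exact polar.add_mem (polar.add_mem (mul_mem_polar (hpolar x) (hpolar y))
          (mul_algebraMap_mem_polar (hpolar x) _)) (mul_algebraMap_mem_polar (hpolar y) _)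
      | add y z hy hz => rw [map_add]; exact polar.add_mem hy hz
    · intro z
      rw [mulPull_toConvLin, tens_mul]
      induction z using TensorProduct.induction_on with
      | zero => rw [map_zero]; exact holo.zero_mem
      | tmul x y => exact mul_mem_holo (hholo x) (hholo y)
      | add y z hy hz => rw [map_add]; exact holo.add_mem hy hz
  obtain ⟨g, hg⟩ := exists_char_of_mul hone hmul
  refine ⟨g, g * φ, by rw [inv_mul_cancel_left], fun x => ?_, fun x hx => ?_⟩
  · have := hholo x
    rwa [← hg, ← toConvLin_mul] at this
  · have := hpolar x
    rwa [← hg, conv_sub_apply, LinearMap.convOne_apply, hx, RingHom.map_zero, sub_zero] at this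

/-- The polar Birkhoff factor of a differentiable curve of characters is differentiable: by
induction on the degree, through the fixed point equation. -/
theorem exists_hasConvDerivAt_of_isBirkhoff {φ gm gp : ℝ → CharGroup H} {φ' : Conv H} {t : ℝ}
    (h : ∀ s, IsBirkhoff (φ s) (gm s) (gp s))
    (hφ : HasConvDerivAt (fun s => toConvLin (φ s)) φ' t) :
    ∃ D, HasConvDerivAt (fun s => toConvLin (gm s)) D t := by
  have hF := hH.isGradedCoalgebra
  -- The points at which a family of linear curves is differentiable at `t` form a subspace.
  let dom {V : Type _} [AddCommGroup V] [Module ℂ V] (E : ℝ → V →ₗ[ℂ] Laurent) : Submodule ℂ V :=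
    { carrier := {x | ∃ a, HasCurveDerivAt (fun s => E s x) a t}
      zero_mem' := ⟨0, by simpa only [map_zero] using hasCurveDerivAt_const 0 t⟩
      add_mem' := fun {x y} ⟨a, ha⟩ ⟨b, hb⟩ => ⟨a + b, by simpa only [map_add] using ha.add hb⟩
      smul_mem' := fun c x ⟨a, ha⟩ => ⟨c • a, by simpa only [map_smul] using ha.const_smul c⟩ }
  have key : ∀ n, Hdeg n ≤ dom fun s => (toConvLin (gm s)).ofConv := by
    intro n
    induction n using Nat.strong_induction_on with
    | _ n ih =>
      intro x hx
      have hψ : HasConvDerivAt (fun s => toConvLin (φ s) - 1) φ' t := fun y => by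
        have := (hφ y).sub (hasCurveDerivAt_const ((1 : Conv H) y) t)
        rwa [sub_zero] at this
      have hle : tensorDeg Hdeg n ≤ dom fun s => LinearMap.mul' ℂ Laurent ∘ₗ
          TensorProduct.map (toConvLin (gm s)).ofConv (toConvLin (φ s) - 1 : Conv H).ofConv := by
        refine tensorDeg_le fun p q hpq y hy w hw => ?_
        rcases Nat.eq_zero_or_pos q with rfl | hq
        · have h0 : ∀ s, (toConvLin (φ s) - 1 : Conv H) w = 0 := fun s =>
            hH.apply_eq_zero (char_sub_one_apply_one (φ s)) w hw
          have h1 : ∀ s, toConvLin (gm s) y * (toConvLin (φ s) - 1 : Conv H) w = 0 := fun s => by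
            rw [h0, mul_zero]
          refine ⟨0, ?_⟩
          change HasCurveDerivAt
            (fun s => toConvLin (gm s) y * (toConvLin (φ s) - 1 : Conv H) w) 0 t
          simpa only [h1] using hasCurveDerivAt_const 0 t
        · obtain ⟨a, ha⟩ := ih p (by omega) hy
          exact ⟨_, ha.mul (hψ w)⟩
      obtain ⟨a, ha⟩ := hle (hF.comul_mem n x hx)
      refine ⟨0 + -polePart a, ?_⟩
      have heq : (fun s => (toConvLin (gm s)).ofConv x) = fun s => (1 : Conv H) x +
          -polePart ((toConvLin (gm s) * (toConvLin (φ s) - 1)) x) :=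
        funext fun s => (h s).fixedPoint x
      rw [heq]
      exact (hasCurveDerivAt_const _ t).add ha.polePart.neg
  refine exists_hasConvDerivAt fun x => ?_
  have hx : x ∈ ⨆ n, Hdeg n := hF.iSup_eq_top ▸ Submodule.mem_top
  exact iSup_le key hx

end Birkhoff

/-! ### Uniqueness of solutions of the Lax equation -/

section Uniqueness

open Laurent

variable {H : Type*} [CommRing H] [HopfAlgebra ℂ H]

theorem RMap_apply (Z : infChar H) (x : H) :
    (RMap Z : Conv H) x = (Z : Conv H) x - polePart ((Z : Conv H) x) - polePart ((Z : Conv H) x) :=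
  rfl

theorem infChar_smul_coe (c : ℂ) (Z : infChar H) :
    ((c • Z : infChar H) : Conv H) = c • (Z : Conv H) := rfl

theorem IsLaxSolutionOn.mono {M : infChar H → infChar H} {L₀ : infChar H} {I J : Set ℝ}
    {L : ℝ → infChar H} (h : IsLaxSolutionOn M L₀ J L) (hIJ : I ⊆ J) : IsLaxSolutionOn M L₀ I L :=
  ⟨h.initial, fun x => (h.continuousOn x).mono hIJ, fun t ht => h.hasDerivAt t (hIJ ht)⟩

variable {Hdeg : ℕ → Submodule ℂ H} [GradedAlgebra Hdeg] (hH : IsConnectedGraded Hdeg)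
  {I : Set ℝ} (hI : IsOpen I) (hc : I.OrdConnected) (h0 : (0 : ℝ) ∈ I)
include hH hI hc h0

/-- The path-ordered exponential: `k' = k ⋆ A`, `k(0) = 1` has a solution in the group of characters
for every continuous curve `A` of infinitesimal characters. -/
theorem exists_char_curve {A : ℝ → infChar H}
    (hA : ∀ x : H, CurveContinuousOn (fun t => (A t : Conv H) x) I) :
    ∃ k : ℝ → CharGroup H, k 0 = 1 ∧
      ∀ t ∈ I, HasConvDerivAt (fun s => toConvLin (k s)) (toConvLin (k t) * (A t : Conv H)) t := by
  let Ã : WithConv (H →ₗ[ℂ] contCurves I) := WithConv.toConv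
    { toFun := fun x => ⟨fun t => (A t : Conv H) x, hA x⟩
      map_add' := fun x y => Subtype.ext (funext fun t => map_add _ x y)
      map_smul' := fun c x => Subtype.ext (funext fun t => map_smul _ c x) }
  have hÃ : Ã 1 = 0 := Subtype.ext (funext fun t => IsInfChar.apply_one (A t).2)
  obtain ⟨K, hK⟩ := hH.isGradedCoalgebra.exists_fixedPoint (hH.apply_eq_zero hÃ) 1
    (primitive hI hc h0)
  let ev (t : ℝ) : contCurves I →ₐ[ℂ] Laurent :=
    (Pi.evalAlgHom ℂ (fun _ : ℝ => Laurent) t).comp (contCurves I).val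
  let k (t : ℝ) : Conv H := WithConv.toConv ((ev t).toLinearMap ∘ₗ K.ofConv)
  have hmul : ∀ t, ∀ x, ((K * Ã) x : ℝ → Laurent) t = (k t * (A t : Conv H)) x := fun t x =>
    LinearMap.congr_fun (LinearMap.algHom_comp_convMul_distrib (ev t) K Ã) x
  have hk : ∀ t ∈ I, ∀ x, k t x = (1 : Conv H) x + integral ((K * Ã) x : ℝ → Laurent) t :=
    fun t ht x => by
      rw [← primitive_apply hI hc h0 _ ht]
      exact congrArg (fun u : contCurves I => (u : ℝ → Laurent) t) (hK x)
  have hinit : k 0 = 1 := conv_ext fun x => by rw [hk 0 h0, integral_zero_right, add_zero]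
  have hder : ∀ t ∈ I, HasConvDerivAt k (k t * (A t : Conv H)) t := fun t ht x => by
    have h1 := (hasCurveDerivAt_const ((1 : Conv H) x) t).add
      (CurveContinuousOn.hasCurveDerivAt_integral ((K * Ã) x).2 hI hc h0 ht)
    rw [zero_add, hmul] at h1
    exact h1.congr hI ht fun s hs => hk s hs x
  have hchar : ∀ t, ∃ g : CharGroup H, t ∈ I → toConvLin g = k t := fun t => by
    by_cases ht : t ∈ I
    · obtain ⟨g, hg⟩ := exists_char_of_hasConvDerivAt hH hI hc h0 (fun s _ => (A s).2) hinit hder ht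
      exact ⟨g, fun _ => hg⟩
    · exact ⟨1, fun h => absurd h ht⟩
  choose g hg using hchar
  refine ⟨g, toConvLin_injective ((hg 0 h0).trans hinit), fun t ht => ?_⟩
  rw [hg t ht]
  exact (hder t ht).congr hI ht hg

/-- A solution `L` of `L' = [L, M]` moves in an adjoint orbit, `L = Ad(k⁻¹) L₀` with `k' = k ⋆ M`.
Hence `f ∘ L` satisfies the same equation for every `Ad`-covariant map `f`. -/
theorem IsLaxSolutionOn.hasConvDerivAt_covariant {M f : infChar H → infChar H}
    (hf : IsAdCovariant f) {L₀ : infChar H} {L : ℝ → infChar H} (hL : IsLaxSolutionOn M L₀ I L)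
    {t : ℝ} (ht : t ∈ I) :
    HasConvDerivAt (fun s => (f (L s) : Conv H)) (⁅f (L t), M (L t)⁆ : infChar H) t := by
  obtain ⟨k, hk0, hk⟩ := exists_char_curve hH hI hc h0 hL.continuousOn
  have hF := hH.isGradedCoalgebra
  have hconj : ∀ s ∈ I, toConvLin (k s) * (L s : Conv H) = (L₀ : Conv H) * toConvLin (k s) := by
    refine hF.eq_of_triangular
      (G := fun s => toConvLin (k s) * (L s : Conv H) * (M (L s) : Conv H))
      (M := fun s => (L₀ : Conv H) * toConvLin (k s) * (M (L s) : Conv H)) hI hc h0 ?_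
      (fun s hs => ?_) (fun s hs => ?_) fun n hn x hx s hs => ?_
    · simp only [hk0, hL.initial, toConvLin_one, one_mul, mul_one]
    · refine ((hk s hs).mul (hL.hasDerivAt s hs)).congr_deriv ?_
      rw [lie_coe]
      noncomm_ring
    · refine ((hasConvDerivAt_const (L₀ : Conv H) s).mul (hk s hs)).congr_deriv ?_
      rw [zero_mul, zero_add, mul_assoc]
    · exact hF.mul_apply_congr_left (hH.apply_eq_zero (IsInfChar.apply_one (M (L s)).2))
        (fun m hm y hy => hn m hm y hy s hs) hx
  have hAd : ∀ s ∈ I, L s = Ad (k s)⁻¹ L₀ := fun s hs => Subtype.ext <| by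
    rw [Ad_coe, inv_inv, mul_assoc, ← hconj s hs, ← mul_assoc, toConvLin_inv_mul, one_mul]
  have hfL : ∀ s ∈ I, (f (L s) : Conv H) =
      toConvLin (k s)⁻¹ * (f L₀ : Conv H) * toConvLin (k s) := fun s hs => by
    rw [hAd s hs, ← hf, Ad_coe, inv_inv]
  refine (((hk t ht).conj (f L₀ : Conv H)).congr hI ht hfL).congr_deriv ?_
  rw [lie_coe, hfL t ht]

/-- Uniqueness for `K' = [K, M]`, where `M` in degrees less than `n` is determined by `K` in these
degrees. -/
theorem eq_of_hasConvDerivAt_lie {K L M N : ℝ → infChar H} (hinit : K 0 = L 0)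
    (hK : ∀ t ∈ I, HasConvDerivAt (fun s => (K s : Conv H)) (⁅K t, M t⁆ : infChar H) t)
    (hL : ∀ t ∈ I, HasConvDerivAt (fun s => (L s : Conv H)) (⁅L t, N t⁆ : infChar H) t)
    (h : ∀ t ∈ I, ∀ x, (K t : Conv H) x = (L t : Conv H) x → (M t : Conv H) x = (N t : Conv H) x) :
    ∀ t ∈ I, K t = L t := by
  have hF := hH.isGradedCoalgebra
  have hzero : ∀ Z : infChar H, ∀ x ∈ Hdeg 0, (Z : Conv H) x = 0 := fun Z =>
    hH.apply_eq_zero (IsInfChar.apply_one Z.2)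
  refine fun t ht => Subtype.ext (hF.eq_of_triangular (K := fun s => (K s : Conv H))
    (L := fun s => (L s : Conv H)) (G := fun s => (⁅K s, M s⁆ : infChar H))
    (M := fun s => (⁅L s, N s⁆ : infChar H)) hI hc h0 (congrArg _ hinit) hK hL
    (fun n hn x hx s hs => ?_) t ht)
  have hKL : ∀ m < n, ∀ y ∈ Hdeg m, (K s : Conv H) y = (L s : Conv H) y :=
    fun m hm y hy => hn m hm y hy s hs
  have hMN : ∀ m < n, ∀ y ∈ Hdeg m, (M s : Conv H) y = (N s : Conv H) y :=
    fun m hm y hy => h s hs y (hKL m hm y hy)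
  rw [lie_coe, lie_coe, conv_sub_apply, conv_sub_apply,
    hF.mul_apply_congr_left (hzero (M s)) hKL hx, hF.mul_apply_congr_right (hzero (L s)) hMN hx,
    hF.mul_apply_congr_right (hzero (M s)) hKL hx, hF.mul_apply_congr_left (hzero (L s)) hMN hx]

/-- Two solutions `L` and `L'` coincide: `f ∘ L` and `f ∘ L'` solve the same triangular equation
`F' = [F, M]`, `M = R F / 2`, so `M` is the same for both, and `L' = [L, M]` is triangular. -/
theorem IsLaxSolutionOn.unique {f : infChar H → infChar H} (hf : IsAdCovariant f)
    {L₀ : infChar H} {L L' : ℝ → infChar H}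
    (hL : IsLaxSolutionOn (fun L => (1 / 2 : ℂ) • RMap (f L)) L₀ I L)
    (hL' : IsLaxSolutionOn (fun L => (1 / 2 : ℂ) • RMap (f L)) L₀ I L') :
    ∀ t ∈ I, L t = L' t := by
  have hR : ∀ Z W : infChar H, ∀ x, (Z : Conv H) x = (W : Conv H) x →
      (((1 / 2 : ℂ) • RMap Z : infChar H) : Conv H) x =
        (((1 / 2 : ℂ) • RMap W : infChar H) : Conv H) x := fun Z W x h => by
    rw [infChar_smul_coe, infChar_smul_coe, conv_smul_apply, conv_smul_apply, RMap_apply,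
      RMap_apply, h]
  have hinit : L 0 = L' 0 := hL.initial.trans hL'.initial.symm
  have hfeq : ∀ t ∈ I, f (L t) = f (L' t) :=
    eq_of_hasConvDerivAt_lie hH hI hc h0 (K := fun t => f (L t)) (L := fun t => f (L' t))
      (congrArg f hinit) (fun t ht => hL.hasConvDerivAt_covariant hH hI hc h0 hf ht)
      (fun t ht => hL'.hasConvDerivAt_covariant hH hI hc h0 hf ht) fun t _ x => hR _ _ x
  exact eq_of_hasConvDerivAt_lie hH hI hc h0 (K := L) (L := L')
    (M := fun t => (1 / 2 : ℂ) • RMap (f (L t))) (N := fun t => (1 / 2 : ℂ) • RMap (f (L' t)))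
    hinit (fun t ht => hL.hasDerivAt t ht)
    (fun t ht => hL'.hasDerivAt t ht) fun t ht x _ => by rw [hfeq t ht]

end Uniqueness

/-! ### The Birkhoff factors solve the Lax equation -/

section Existence

open Laurent

variable {H : Type*} [CommRing H] [HopfAlgebra ℂ H]
  {Hdeg : ℕ → Submodule ℂ H} [GradedAlgebra Hdeg] (hH : IsConnectedGraded Hdeg)

theorem isBirkhoff_one : IsBirkhoff (1 : CharGroup H) 1 1 := by
  refine ⟨by rw [inv_one, one_mul], fun x => algebraMap_mem_holo _, fun x hx => ?_⟩
  rw [AlgHom.convOne_apply, hx, RingHom.map_zero]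
  exact polar.zero_mem

theorem Ad_one (Z : infChar H) : Ad 1 Z = Z := Subtype.ext <| by
  rw [Ad_coe, inv_one, toConvLin_one, one_mul, mul_one]

include hH

variable {f : infChar H → infChar H} {L₀ : infChar H} {φ gm gp : ℝ → CharGroup H}

/-- If `exp(-tX) = g₋⁻¹ ⋆ g₊`, then `g₊' = b ⋆ g₊` with `R(Ad(g₊) X) = -2 b - Ad(g₊) X`. Indeed
`Ad(g₊) X = a - b` with `a = g₋' ⋆ g₋⁻¹` polar and `b = g₊' ⋆ g₊⁻¹` holomorphic. -/
theorem exists_hasConvDerivAt_holoFactor {X : infChar H}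
    (h : ∀ t : ℝ, IsExp (-(t : ℂ) • X) (φ t) ∧ IsBirkhoff (φ t) (gm t) (gp t)) (t : ℝ) :
    ∃ b : Conv H, HasConvDerivAt (fun s => toConvLin (gp s)) (b * toConvLin (gp t)) t ∧
      (RMap (Ad (gp t) X) : Conv H) = -(2 : ℂ) • b - (Ad (gp t) X : Conv H) := by
  have hexp : ∀ s, toConvLin (φ s) = expConv Hdeg (-(s : ℂ) • (X : Conv H)) := fun s => by
    rw [(isExp_iff hH).1 (h s).1, infChar_smul_coe]
  have hφ : HasConvDerivAt (fun s => toConvLin (φ s)) (toConvLin (φ t) * -(X : Conv H)) t := by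
    simp only [hexp]
    exact hasConvDerivAt_expConv hH X.2.apply_one t
  obtain ⟨D, hD⟩ := exists_hasConvDerivAt_of_isBirkhoff hH (fun s => (h s).2) hφ
  have hgp : ∀ s, toConvLin (gp s) = toConvLin (gm s) * toConvLin (φ s) := fun s => by
    rw [← toConvLin_mul, (h s).2.mul_eq]
  have hE : HasConvDerivAt (fun s => toConvLin (gp s))
      (D * toConvLin (φ t) + toConvLin (gm t) * (toConvLin (φ t) * -(X : Conv H))) t := by
    simp only [hgp]
    exact hD.mul hφ
  generalize hEdef : D * toConvLin (φ t) + toConvLin (gm t) * (toConvLin (φ t) * -(X : Conv H)) = E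
    at hE
  have hDpolar : ∀ x, D x ∈ polar := fun x => by
    have h1 := (hD x).sub (hasCurveDerivAt_const ((1 : Conv H) x) t)
    rw [sub_zero] at h1
    exact h1.mem_polar fun s => (h s).2.sub_one_mem x
  have hEholo : ∀ x, E x ∈ holo := fun x => (hE x).mem_holo fun s => (h s).2.2.1 x
  have ha : ∀ x, (D * toConvLin (gm t)⁻¹) x ∈ polar := conv_mul_mem polar fun x y => by
    have h1 : toConvLin (gm t)⁻¹ y = (toConvLin (gm t) - 1 : Conv H) (HopfAlgebra.antipode ℂ y) +
        algebraMap ℂ Laurent (Coalgebra.counit (R := ℂ) (HopfAlgebra.antipode ℂ y)) :=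
      (sub_add_cancel _ _).symm
    rw [h1, mul_add]
    exact polar.add_mem (mul_mem_polar (hDpolar x) ((h t).2.sub_one_mem _))
      (mul_algebraMap_mem_polar (hDpolar x) _)
  have hb : ∀ x, (E * toConvLin (gp t)⁻¹) x ∈ holo := conv_mul_mem holo fun x y =>
    mul_mem_holo (hEholo x) ((h t).2.2.1 (HopfAlgebra.antipode ℂ y))
  have hφgp : toConvLin (φ t) * toConvLin (gp t)⁻¹ = toConvLin (gm t)⁻¹ := by
    rw [← toConvLin_mul, ← (h t).2.mul_eq, mul_inv_rev, mul_inv_cancel_left]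
  have hAd : (Ad (gp t) X : Conv H) = D * toConvLin (gm t)⁻¹ - E * toConvLin (gp t)⁻¹ := by
    rw [Ad_coe, ← hEdef, add_mul, mul_assoc D, hφgp, hgp]
    noncomm_ring
  refine ⟨E * toConvLin (gp t)⁻¹, ?_, conv_ext fun x => ?_⟩
  · rwa [mul_assoc, toConvLin_inv_mul, mul_one]
  · rw [RMap_apply, hAd, conv_sub_apply, conv_sub_apply, conv_sub_apply, conv_smul_apply, map_sub,
      polePart_of_mem_polar (ha x), polePart_of_mem_holo (hb x), neg_smul, ofNat_smul_eq_nsmul,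
      two_nsmul]
    abel

theorem isLaxSolutionOn_birkhoff (hf : IsAdCovariant f) (hcomm : ⁅f L₀, L₀⁆ = 0)
    (h : ∀ t : ℝ, IsExp (-(t : ℂ) • f L₀) (φ t) ∧ IsBirkhoff (φ t) (gm t) (gp t)) :
    IsLaxSolutionOn (fun L => (1 / 2 : ℂ) • RMap (f L)) L₀ Set.univ (fun t => Ad (gp t) L₀) := by
  have hder : ∀ t, ∃ b : Conv H, (∀ Z : infChar H, HasConvDerivAt (fun s => (Ad (gp s) Z : Conv H))
      ((Ad (gp t) Z : Conv H) * -b - -b * (Ad (gp t) Z : Conv H)) t) ∧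
      (RMap (Ad (gp t) (f L₀)) : Conv H) = -(2 : ℂ) • b - (Ad (gp t) (f L₀) : Conv H) := fun t => by
    obtain ⟨b, hb, hR⟩ := exists_hasConvDerivAt_holoFactor hH h t
    refine ⟨b, fun Z => ?_, hR⟩
    have h1 : HasConvDerivAt (fun s => toConvLin (gp s)⁻¹) (toConvLin (gp t)⁻¹ * -b) t := by
      refine hb.inv.congr_deriv ?_
      rw [mul_assoc, mul_assoc, toConvLin_mul_inv, mul_one, mul_neg]
    have h2 := h1.conj (Z : Conv H)
    simp only [inv_inv] at h2
    exact h2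
  refine ⟨?_, fun x => ?_, fun t _ => ?_⟩
  · have h1 : φ 0 = 1 := toConvLin_injective <| by
      rw [(isExp_iff hH).1 (h 0).1, toConvLin_one, infChar_smul_coe, Complex.ofReal_zero, neg_zero,
        zero_smul]
      exact expConv_zero hH
    have h2 := (h 0).2
    rw [h1] at h2
    rw [(h2.unique hH isBirkhoff_one).2]
    exact Ad_one L₀
  · choose b hb using fun t => hder t
    have h1 : ∀ t ∈ Set.univ, _ := fun t (_ : t ∈ Set.univ) =>
      ((((hb t).1 (f L₀) x).sub ((hb t).1 (f L₀) x).polePart).sub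
        ((hb t).1 (f L₀) x).polePart).const_smul (1 / 2 : ℂ)
    have h2 := curveContinuousOn_of_hasCurveDerivAt h1
    have h3 : ∀ t, f (Ad (gp t) L₀) = Ad (gp t) (f L₀) := fun t => (hf _ _).symm
    simp only [h3]
    exact h2
  · obtain ⟨b, hb, hR⟩ := hder t
    -- `M = -b - f(L) / 2`, and `f(L) = Ad(g₊) f(L₀)` commutes with `L = Ad(g₊) L₀`.
    refine (hb L₀).congr_deriv ?_
    have hFL : (Ad (gp t) (f L₀) : Conv H) * (Ad (gp t) L₀ : Conv H) =
        (Ad (gp t) L₀ : Conv H) * (Ad (gp t) (f L₀) : Conv H) := by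
      have h1 : (f L₀ : Conv H) * L₀ = L₀ * (f L₀ : Conv H) := by
        rw [← sub_eq_zero, ← lie_coe, hcomm]
        rfl
      have h2 : ∀ Z W : Conv H, toConvLin (gp t) * Z * toConvLin (gp t)⁻¹ *
          (toConvLin (gp t) * W * toConvLin (gp t)⁻¹) =
            toConvLin (gp t) * (Z * W) * toConvLin (gp t)⁻¹ := fun Z W => by
        calc _ = toConvLin (gp t) * Z * (toConvLin (gp t)⁻¹ * toConvLin (gp t)) * W *
              toConvLin (gp t)⁻¹ := by noncomm_ring
          _ = _ := by rw [toConvLin_inv_mul]; noncomm_ring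
      rw [Ad_coe, Ad_coe, h2, h2, h1]
    rw [lie_coe, ← hf, infChar_smul_coe, hR, smul_sub, smul_smul, mul_sub, sub_mul,
      mul_smul_comm _ _ (Ad (gp t) (f L₀) : Conv H),
      smul_mul_assoc _ (Ad (gp t) (f L₀) : Conv H), hFL]
    norm_num

theorem isSolvedByBirkhoff (hf : IsAdCovariant f) (hcomm : ⁅f L₀, L₀⁆ = 0) :
    IsSolvedByBirkhoff (fun L => (1 / 2 : ℂ) • RMap (f L)) L₀ (f L₀) := by
  refine ⟨fun t => ?_, fun φ gm gp h => ?_⟩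
  · obtain ⟨φ, hφ⟩ := exists_isExp hH (f L₀) t
    obtain ⟨gm, gp, hg⟩ := exists_isBirkhoff hH φ
    refine ⟨φ, hφ, (gm, gp), hg, fun p hp => ?_⟩
    obtain ⟨h1, h2⟩ := IsBirkhoff.unique hH hp hg
    exact Prod.ext h1 h2
  · have hsol := isLaxSolutionOn_birkhoff hH hf hcomm h
    refine ⟨fun t => Subtype.ext ?_, hsol, fun I hI hc h0 L hL t ht =>
      hL.unique hH hI hc h0 hf (hsol.mono (Set.subset_univ I)) t ht⟩
    have hXL : Commute (f L₀ : Conv H) (L₀ : Conv H) := by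
      rw [Commute, SemiconjBy, ← sub_eq_zero, ← lie_coe, hcomm]
      rfl
    have hφ : toConvLin (φ t) * (L₀ : Conv H) = L₀ * toConvLin (φ t) := by
      rw [(isExp_iff hH).1 (h t).1]
      exact expConv_commute hH (IsInfChar.apply_one (-(t : ℂ) • f L₀).2)
        (IsInfChar.apply_one L₀.2) (hXL.smul_left _)
    rw [Ad_coe, Ad_coe, ← (h t).2.mul_eq, mul_inv_rev, toConvLin_mul, toConvLin_mul,
      mul_assoc (toConvLin (gm t)) (toConvLin (φ t)), hφ]
    have h1 : toConvLin (φ t) * (toConvLin (φ t)⁻¹ * toConvLin (gm t)⁻¹) = toConvLin (gm t)⁻¹ := by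
      rw [← mul_assoc, toConvLin_mul_inv, one_mul]
    rw [mul_assoc, mul_assoc, mul_assoc, h1]

end Existence

theorem postcomp_smul {H : Type*} [CommRing H] [HopfAlgebra ℂ H] (T : Laurent →ₗ[ℂ] Laurent)
    (c : ℂ) (Z : infChar H) : postcomp T (c • Z) = c • postcomp T Z :=
  Subtype.ext (conv_ext fun x => map_smul T c ((Z : Conv H) x))

theorem isAdCovariant_smul {H : Type*} [CommRing H] [HopfAlgebra ℂ H] (c : ℂ) (a : Laurent) :
    IsAdCovariant fun L : infChar H => c • a • L := fun g L => Subtype.ext <| by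
  change toConvLin g * (c • a • (L : Conv H)) * toConvLin g⁻¹ =
    c • a • (toConvLin g * (L : Conv H) * toConvLin g⁻¹)
  rw [mul_smul_comm, mul_smul_comm, smul_mul_assoc, smul_mul_assoc]

end LaxHopf

end

theorem theorem5p6 {H : Type*} [CommRing H] [HopfAlgebra ℂ H]
    (Hdeg : ℕ → Submodule ℂ H) [GradedAlgebra Hdeg] (hH : LaxHopf.IsConnectedGraded Hdeg) :
    (∀ f : LaxHopf.infChar H → LaxHopf.infChar H, LaxHopf.IsAdCovariant f →
      ∀ L₀ : LaxHopf.infChar H, ⁅f L₀, L₀⁆ = 0 →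
        LaxHopf.IsSolvedByBirkhoff (fun L => (1 / 2 : ℂ) • LaxHopf.RMap (f L)) L₀ (f L₀)) ∧
    (∀ n m : ℤ,
      LaxHopf.IsAdCovariant
        (fun L : LaxHopf.infChar H => (2 : ℂ) • LaxHopf.Laurent.lamPow (-n + 2 * m) • L) ∧
      ∀ L₀ : LaxHopf.infChar H,
        ⁅(2 : ℂ) • LaxHopf.Laurent.lamPow (-n + 2 * m) • L₀, L₀⁆ = 0 ∧
        LaxHopf.IsSolvedByBirkhoff
          (fun L => LaxHopf.RMap (LaxHopf.Laurent.lamPow (-n + 2 * m) • L)) L₀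
          ((2 : ℂ) • LaxHopf.Laurent.lamPow (-n + 2 * m) • L₀)) := by
  refine ⟨fun f hf L₀ hcomm => LaxHopf.isSolvedByBirkhoff hH hf hcomm, fun n m => ?_⟩
  have hcov := LaxHopf.isAdCovariant_smul (H := H) 2 (LaxHopf.Laurent.lamPow (-n + 2 * m))
  have hM : (fun L : LaxHopf.infChar H => LaxHopf.RMap (LaxHopf.Laurent.lamPow (-n + 2 * m) • L)) =
      fun L => (1 / 2 : ℂ) •
        LaxHopf.RMap ((2 : ℂ) • LaxHopf.Laurent.lamPow (-n + 2 * m) • L) := by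
    funext L
    rw [LaxHopf.RMap, LaxHopf.RMap, LaxHopf.postcomp_smul, LaxHopf.postcomp_smul, ← smul_sub,
      smul_smul]
    norm_num
  refine ⟨hcov, fun L₀ => ?_⟩
  have hcomm : ⁅(2 : ℂ) • LaxHopf.Laurent.lamPow (-n + 2 * m) • L₀, L₀⁆ = 0 := Subtype.ext <| by
    rw [LaxHopf.lie_coe]
    change (2 : ℂ) • LaxHopf.Laurent.lamPow (-n + 2 * m) • (L₀ : LaxHopf.Conv H) * L₀ -
      L₀ * ((2 : ℂ) • LaxHopf.Laurent.lamPow (-n + 2 * m) • (L₀ : LaxHopf.Conv H)) = 0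
    rw [mul_smul_comm, mul_smul_comm, smul_mul_assoc, smul_mul_assoc, sub_self]
  refine ⟨hcomm, ?_⟩
  rw [hM]
  exact LaxHopf.isSolvedByBirkhoff hH hcov hcomm
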